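/- Let $n\ge 3$ be odd. For a smooth function $\alpha:\mathbb R\to(-1,1)$ with $\alpha(0)=0$, let $g_\alpha=(g_{jk})=(g^{jk})^{-1}$ be the Riemannian metric on $\mathbb R^n$ dual to the cometric $$\sum_{j,k=1}^n g^{jk}(x)\,d\xi_j\,d\xi_k=\sum_{j=1}^n d\xi_j^2+2\alpha\bigl(x_{(n+1)/2}\bigr)\sum_{j=1}^{(n-1)/2}d\xi_{(n+1)/2-j}\,d\xi_{(n+1)/2+j},$$ and let $\mathrm{dist}_\alpha$ be its Riemannian distance. Call $a$ an admissible amplitude if $0\le a\in C_0^\infty(\mathbb R^n\times\mathbb R^n)$, $a$ vanishes in a neighbourhood of the diagonal, and $a(0,-e_{(n+1)/2})\neq 0$, where $e_{(n+1)/2}$ is the middle coordinate vector; admissible amplitudes exist. Put $$S_\lambda f(x)=\int_{\mathbb R^n}e^{i\lambda\,\mathrm{dist}_\alpha(x,y)}\,a(x,y)\,f(y)\,dy .$$ For $1\le p,q\le\infty$ let $(\mathrm B_{p,q})$ be the assertion that for every $\varepsilon>0$ there is $C_\varepsilon$ such that $$\|S_\lambda f\|_{L^q(\mathbb R^n)}\le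 C_\varepsilon\,\lambda^{-n/q+\varepsilon}\,\|f\|_{L^p(\mathbb R^n)}\qquad\text{for all }\lambda\ge1,\ f\in L^p(\mathbb R^n).$$ Let $q_n=\frac{2(3n+1)}{3(n-1)}$; then $q_n>\frac{2n}{n-1}$. (1) Let $\alpha(s)=e^{1/s}$ for $s<0$ and $\alpha(s)=0$ for $s\ge0$; then $g_\alpha$ is a $C^\infty$ Riemannian metric. Let $a$ be any admissible amplitude and $1\le q\le\infty$. If $(\mathrm B_{\infty,q})$ holds, then $q\ge q_n$. Likewise, if $(\mathrm B_{p,q})$ holds for the exponent $p$ with $q=\frac{n+1}{n-1}p'$, where $\frac1p+\frac1{p'}=1$, then $q\ge q_n$. In particular, for $n=3$ both bounds fail when $3\le q<10/3$. (2) For every $q$ with $\frac{2n}{n-1}\le q<q_n$ there is a real analytic $\alpha:\mathbb R\to(-1,1)$ with $\alpha(0)=0$, for which $g_\alpha$ is a real analytic Riemannian metric on $\mathbb R^n$, such that for every admissible amplitude $a$ both $(\mathrm B_{\infty,q})$ and $(\mathrm B_{p,q})$ with $q=\frac{n+1}{n-1}p'$ fail. -/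

import Mathlib

open MeasureTheory Filter Topology
open scoped ENNReal ContDiff Manifold

noncomputable section

/-- Euclidean space `ℝⁿ`, with coordinates indexed by `0, …, n - 1`. -/
abbrev RSpace (n : ℕ) : Type := EuclideanSpace ℝ (Fin n)

/-- The middle index. In the one-based numbering of coordinates and for odd `n` this is the index
`(n + 1) / 2`; the coordinates here are numbered from `0`. -/
def midIndex (n : ℕ) [NeZero n] : Fin n :=
  ⟨(n - 1) / 2, by have := NeZero.pos n; omega⟩

/-- The point with middle coordinate `-1` and all other coordinates `0`. -/
def basePoint (n : ℕ) [NeZero n] : RSpace n := EuclideanSpace.single (midIndex n) (-1)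

/-- For odd `n`, the matrix of the cometric
`dξ² + 2 α(x_{(n+1)/2}) ∑_{j=1}^{(n-1)/2} dξ_{(n+1)/2-j} dξ_{(n+1)/2+j}` (one-based indices) at the
point `x`. In zero-based indices, `i` and `k` are of the form `c - j` and `c + j`, with
`c = (n - 1) / 2` and `j ≠ 0`, if and only if `i + k = n - 1` and `i ≠ k`. -/
def cometric (n : ℕ) [NeZero n] (α : ℝ → ℝ) (x : RSpace n) : Matrix (Fin n) (Fin n) ℝ :=
  Matrix.of fun i k =>
    if i = k then 1 else if (i : ℕ) + (k : ℕ) + 1 = n then α (x (midIndex n)) else 0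

/-- The matrix field `g_{jk}` of the metric dual to `cometric`. -/
def dualMetric (n : ℕ) [NeZero n] (α : ℝ → ℝ) (x : RSpace n) : Matrix (Fin n) (Fin n) ℝ :=
  (cometric n α x)⁻¹

/-- The matrix field `g` on `ℝⁿ` is a Riemannian metric of class `C^r`
(`r = ∞`: smooth, `r = ω`: real analytic). -/
def IsMetricOfClass {n : ℕ} (r : ℕ∞ω) (g : RSpace n → Matrix (Fin n) (Fin n) ℝ) : Prop :=
  (∀ x, (g x).PosDef) ∧ ∀ j k, ContDiff ℝ r fun x => g x j k

/-- The length `(∑ g_{jk}(x) v_j v_k)^{1/2}` of tangent vectors for the metric `g`. -/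
@[reducible]
def tangentENorm {n : ℕ} (g : RSpace n → Matrix (Fin n) (Fin n) ℝ) (x : RSpace n) :
    ENorm (TangentSpace 𝓘(ℝ, RSpace n) x) :=
  ⟨fun v : RSpace n => ENNReal.ofReal (Real.sqrt (∑ j, ∑ k, g x j k * v j * v k))⟩

/-- The Riemannian distance of `ℝⁿ` with the metric `g`: the infimum of the `g`-lengths of the `C¹`
paths between two points. -/
def metricDist {n : ℕ} (g : RSpace n → Matrix (Fin n) (Fin n) ℝ) (x y : RSpace n) : ℝ :=
  letI : ∀ z : RSpace n, ENorm (TangentSpace 𝓘(ℝ, RSpace n) z) := tangentENorm g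
  (Manifold.riemannianEDist 𝓘(ℝ, RSpace n) x y).toReal

/-- The function `α` with `α(s) = e^{1/s}` for `s < 0` and `α(s) = 0` for `s ≥ 0`. -/
def flatAlpha (s : ℝ) : ℝ := if s < 0 then Real.exp (1 / s) else 0

/-- The amplitudes: nonnegative, in `C_0^∞(ℝⁿ × ℝⁿ)`, zero in a neighbourhood of the diagonal, and
nonzero at `x = 0`, `y = -e_{(n+1)/2}`. -/
structure IsAmplitude (n : ℕ) [NeZero n] (a : RSpace n → RSpace n → ℝ) : Prop where
  smooth : ContDiff ℝ ∞ fun z : RSpace n × RSpace n => a z.1 z.2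
  compactSupport : HasCompactSupport fun z : RSpace n × RSpace n => a z.1 z.2
  nonneg : ∀ x y, 0 ≤ a x y
  offDiagonal : ∀ x, ∀ᶠ z : RSpace n × RSpace n in 𝓝 (x, x), a z.1 z.2 = 0
  ne_zero : a 0 (basePoint n) ≠ 0

/-- The operator `S_λ f(x) = ∫ e^{iλ d(x,y)} a(x,y) f(y) dy`. -/
def oscOp {n : ℕ} (d a : RSpace n → RSpace n → ℝ) (lam : ℝ) (f : RSpace n → ℂ)
    (x : RSpace n) : ℂ :=
  ∫ y, Complex.exp (Complex.I * (lam * d x y : ℝ)) * (a x y : ℂ) * f y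

/-- The bounds `‖S_λ f‖_q ≤ C_ε λ^{-n/q+ε} ‖f‖_p` for all `ε > 0`, with `C_ε` independent of
`λ ≥ 1` and `f ∈ L^p`. Here `n/q = 0` if `q = ∞`. -/
def OscBound {n : ℕ} (d a : RSpace n → RSpace n → ℝ) (p q : ℝ≥0∞) : Prop :=
  ∀ ε : ℝ, 0 < ε → ∃ C : ℝ, ∀ lam : ℝ, 1 ≤ lam → ∀ f : RSpace n → ℂ, MemLp f p volume →
    eLpNorm (oscOp d a lam f) q volume ≤
      ENNReal.ofReal (C * lam ^ (-((n : ℝ) / q.toReal) + ε)) * eLpNorm f p volume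

/-- The relation `q = (n+1) p' / (n-1)`, with `p'` the exponent conjugate to `p`. -/
def ExponentRelation (n : ℕ) (p q : ℝ≥0∞) : Prop :=
  ∃ p' : ℝ≥0∞, p.HolderConjugate p' ∧ q = ENNReal.ofReal (((n : ℝ) + 1) / ((n : ℝ) - 1)) * p'

/-- The critical exponent `q_n = 2(3n+1) / (3(n-1))`. -/
def critExponent (n : ℕ) : ℝ := 2 * (3 * (n : ℝ) + 1) / (3 * ((n : ℝ) - 1))

end

/-!
Write `n = 2 m + 1`, let `t` be the middle coordinate, and pair the remaining coordinates as
`x_i`, `x_{rev i}` with `i` below the middle index. Completing the square in the dual metric gives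
the length element `dt² + ∑ (dx_i² + (dx_{rev i} - α(t) dx_i)² / (1 - α(t)²))`
(`dualMetric_quadForm`). Consequently, every linear functional of `t` and the `x_i` of Euclidean
norm one is a calibration, and the curves with `dx_i = v_i dt`, `dx_{rev i} = α(t) v_i dt` are
geodesics, calibrated by `slopeFunctional n v`. These form a `2 m`-parameter family, with
parameters the slopes `v_i` and the positions `x_i` at height `t = 0`, if one requires
`x_{rev i} = 0` at `t = 0`. Where `α` vanishes for `t ≥ 0`, or vanishes to high order at `0`, all of
them stay (nearly) in the `(m + 1)`-plane `x_{rev i} = 0` for small `t ≥ 0`. Near `t = -1` they fill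
an open set, because `x_{rev i} = v_i ∫_0^t α` there and the integral is not zero. This is a
Nikodym-type compression phenomenon.

The distance between two points that are within `ρ` of one of these geodesics is the calibrating
linear functional up to `O(ρ²)`: the calibration bounds it from below
(`slopeFunctional_le_metricDist`) and an explicit path bounds it from above
(`metricDist_sub_slopeFunctional_le`). At frequency `λ ≈ r⁻²` the operator therefore maps a plane
wave, cut off to the part near `t = -1` of the tube of width `r` around such a geodesic, without
cancellation to the top part of the tube, which lies in the slab `|x_{rev i}| ≤ r`, `0 ≤ t ≤ h`.
The tubes partition a ball around the base point. Superposing the plane waves with suitable signs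
yields a function bounded by one whose image has square norm at least `c h r^{4 m}` in the slab
(`exists_bounded_le_lintegral_slab`). The signs come from the parallelogram law
(`exists_signs_sum_lintegral_sq_le`), and the Cauchy–Schwarz inequality shows that the number of
tubes and the measure of the ball determine the bound.

The slab has measure about `h r^m`. Hölder's inequality and an `L^q` bound for the operator would
thus give an upper bound for the same square norm, and with `r = h ^ N`, `h → 0`, this contradicts
the lower bound when `q` is less than the critical exponent by a multiple of `1 / N`
(`not_oscBound_of_flat`). The function `flatAlpha` vanishes to infinite order, which allows every
`N`; for real analytic examples, `α` vanishing to finite order `2 N` is enough for a given `q`. Only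
the size and the support of the test function matter, so that the exponent `p` plays no role.
-/

/-! ### The dual metric -/

theorem rev_midIndex (n : ℕ) [NeZero n] (hodd : Odd n) : (midIndex n).rev = midIndex n := by
  obtain ⟨m, rfl⟩ := hodd
  ext
  simp [midIndex, Fin.val_rev]
  omega

theorem card_Iio_midIndex (n : ℕ) [NeZero n] : (Finset.Iio (midIndex n)).card = (n - 1) / 2 := by
  simp [midIndex]

@[to_additive]
theorem prod_eq_mid_mul_prod_pairs {n : ℕ} [NeZero n] (hodd : Odd n) {M : Type*} [CommMonoid M]
    (F : Fin n → M) :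
    ∏ i, F i = F (midIndex n) * ∏ i ∈ Finset.Iio (midIndex n), (F i * F i.rev) := by
  have hrev := rev_midIndex n hodd
  have h1 : (Finset.univ : Finset (Fin n)) =
      insert (midIndex n) (Finset.Iio (midIndex n) ∪ Finset.Ioi (midIndex n)) := by
    ext i
    simp only [Finset.mem_univ, Finset.mem_insert, Finset.mem_union, Finset.mem_Iio,
      Finset.mem_Ioi, true_iff]
    rcases lt_trichotomy i (midIndex n) with h | h | h <;> simp [h]
  have hd : Disjoint (Finset.Iio (midIndex n)) (Finset.Ioi (midIndex n)) := by
    rw [Finset.disjoint_left]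
    intro i hi hi'
    exact absurd (Finset.mem_Iio.1 hi) (not_lt.2 (Finset.mem_Ioi.1 hi').le)
  rw [h1, Finset.prod_insert (by simp), Finset.prod_union hd, Finset.prod_mul_distrib]
  congr 2
  refine Finset.prod_nbij' Fin.rev Fin.rev ?_ ?_ ?_ ?_ ?_
  · intro i hi
    rw [Finset.mem_Ioi] at hi
    rw [Finset.mem_Iio, ← hrev]
    exact Fin.rev_lt_rev.2 hi
  · intro i hi
    rw [Finset.mem_Iio] at hi
    rw [Finset.mem_Ioi, ← hrev]
    exact Fin.rev_lt_rev.2 hi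
  · simp
  · simp
  · simp

theorem add_add_one_eq_iff_eq_rev {n : ℕ} (i k : Fin n) :
    (i : ℕ) + (k : ℕ) + 1 = n ↔ k = i.rev := by
  rw [Fin.ext_iff, Fin.val_rev]
  omega

/-- The inverse of the cometric matrix in closed form: it couples only the indices `i` and
`i.rev`. -/
theorem dualMetric_eq {n : ℕ} [NeZero n] (hodd : Odd n) {α : ℝ → ℝ} (x : RSpace n)
    (hα : |α (x (midIndex n))| < 1) :
    dualMetric n α x = Matrix.of fun i k =>
      if i = k then (if i = midIndex n then 1 else (1 - α (x (midIndex n)) ^ 2)⁻¹)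
      else if k = i.rev then - α (x (midIndex n)) * (1 - α (x (midIndex n)) ^ 2)⁻¹ else 0 := by
  have hrev := rev_midIndex n hodd
  have hpos : 1 - α (x (midIndex n)) ^ 2 ≠ 0 := by
    have := (sq_lt_one_iff_abs_lt_one _).2 hα
    linarith
  have hfix : ∀ i : Fin n, i.rev = i ↔ i = midIndex n := by
    intro i
    rw [Fin.ext_iff, Fin.ext_iff, Fin.val_rev]
    obtain ⟨m, rfl⟩ := hodd
    simp only [midIndex]
    omega
  unfold dualMetric
  apply Matrix.inv_eq_right_inv
  ext i k
  set a := α (x (midIndex n)) with ha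
  simp only [Matrix.mul_apply, cometric, Matrix.of_apply, add_add_one_eq_iff_eq_rev, ← ha]
  by_cases hi : i = midIndex n
  · rw [Finset.sum_eq_single i]
    · subst hi
      by_cases hk : midIndex n = k
      · subst hk
        simp
      · simp [hk, Ne.symm hk, hrev]
    · intro b _ hb
      have : b ≠ i.rev := by rw [(hfix i).2 hi]; exact hb
      simp [Ne.symm hb, this]
    · simp
  · have hne : i.rev ≠ i := fun h => hi ((hfix i).1 h)
    have hi' : i.rev ≠ midIndex n := fun h => hi (by rw [← Fin.rev_rev i, h, hrev])
    rw [← Finset.sum_subset (Finset.subset_univ {i, i.rev})]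
    · rw [Finset.sum_pair hne.symm]
      by_cases hik : i = k
      · subst hik
        simp [hi, hne.symm, hne]
        field_simp
        ring
      · by_cases hk : k = i.rev
        · subst hk
          simp [hi', hne.symm]
        · have : i.rev ≠ k := fun h => hk h.symm
          have h3 : k ≠ i := fun h => hik h.symm
          simp [hik, hk, hne.symm, this, h3]
    · intro b _ hb
      simp only [Finset.mem_insert, Finset.mem_singleton, not_or] at hb
      simp [Ne.symm hb.1, hb.2]

/-- The quadratic form of the dual metric. Completing the square shows that the direction
`w_{rev i} = α w_i` costs nothing beyond the Euclidean length of `(w_i)` and of the middle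
component. -/
theorem dualMetric_quadForm {n : ℕ} [NeZero n] (hodd : Odd n) {α : ℝ → ℝ} (x : RSpace n)
    (hα : |α (x (midIndex n))| < 1) (w : RSpace n) :
    ∑ j, ∑ k, dualMetric n α x j k * w j * w k =
      w (midIndex n) ^ 2 + ∑ i ∈ Finset.Iio (midIndex n), (w i ^ 2 +
        (w i.rev - α (x (midIndex n)) * w i) ^ 2 / (1 - α (x (midIndex n)) ^ 2)) := by
  have hrev := rev_midIndex n hodd
  have hpos : 1 - α (x (midIndex n)) ^ 2 ≠ 0 := by
    have := (sq_lt_one_iff_abs_lt_one _).2 hα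
    linarith
  rw [dualMetric_eq hodd x hα]
  set a := α (x (midIndex n)) with ha
  have hrow : ∀ j : Fin n, ∀ d o : ℝ, j ≠ j.rev →
      ∑ k, (if j = k then d else if k = j.rev then o else 0) * w j * w k =
        d * w j ^ 2 + o * w j * w j.rev := by
    intro j d o hj
    rw [← Finset.sum_subset (Finset.subset_univ {j, j.rev}), Finset.sum_pair hj]
    · simp [hj]
      ring
    · intro b _ hb
      simp only [Finset.mem_insert, Finset.mem_singleton, not_or] at hb
      simp [Ne.symm hb.1, hb.2]
  rw [sum_eq_mid_add_sum_pairs hodd]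
  congr 1
  · rw [Finset.sum_eq_single (midIndex n)]
    · simp
      ring
    · intro b _ hb
      simp [Ne.symm hb, hrev, hb]
    · simp
  · refine Finset.sum_congr rfl fun i hi => ?_
    rw [Finset.mem_Iio] at hi
    have hi' : midIndex n < i.rev := by rw [← hrev]; exact Fin.rev_lt_rev.2 hi
    simp only [Matrix.of_apply, hi.ne, hi'.ne', if_false]
    rw [hrow i _ _ (hi.trans hi').ne, hrow i.rev _ _ (by simpa using (hi.trans hi').ne'),
      Fin.rev_rev]
    field_simp
    ring

theorem isMetricOfClass_dualMetric {n : ℕ} [NeZero n] (hodd : Odd n) {α : ℝ → ℝ} {r : ℕ∞ω}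
    (hα : ∀ s, |α s| < 1) (hs : ContDiff ℝ r α) : IsMetricOfClass r (dualMetric n α) := by
  have hpos : ∀ s, 0 < 1 - α s ^ 2 := fun s => by
    have := (sq_lt_one_iff_abs_lt_one _).2 (hα s)
    linarith
  refine ⟨fun x => ?_, fun j k => ?_⟩
  · refine Matrix.PosDef.of_dotProduct_mulVec_pos ?_ ?_
    · rw [dualMetric_eq hodd x (hα _)]
      ext i k
      simp only [Matrix.conjTranspose_apply, Matrix.of_apply, star_trivial]
      by_cases h : i = k
      · subst h; rfl
      · have h' : k ≠ i := fun e => h e.symm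
        have : i = k.rev ↔ k = i.rev := by
          constructor <;> (rintro rfl; simp)
        simp [h, h', this]
    · intro w hw
      have key := dualMetric_quadForm hodd x (hα _) (WithLp.toLp 2 w)
      have heq : star w ⬝ᵥ (dualMetric n α x).mulVec w =
          ∑ j, ∑ k, dualMetric n α x j k * w j * w k := by
        simp only [dotProduct, Matrix.mulVec, Finset.mul_sum, star_trivial]
        refine Finset.sum_congr rfl fun j _ => Finset.sum_congr rfl fun k _ => by ring
      rw [heq]
      rw [key]
      have hterm : ∀ i ∈ Finset.Iio (midIndex n), 0 ≤ w i ^ 2 +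
          (w i.rev - α (x (midIndex n)) * w i) ^ 2 / (1 - α (x (midIndex n)) ^ 2) := fun i _ =>
        add_nonneg (sq_nonneg _) (div_nonneg (sq_nonneg _) (hpos _).le)
      refine lt_of_le_of_ne (add_nonneg (sq_nonneg _) (Finset.sum_nonneg hterm)) fun h0 => hw ?_
      have h1 := (add_eq_zero_iff_of_nonneg (sq_nonneg _) (Finset.sum_nonneg hterm)).1 h0.symm
      have h2 := (Finset.sum_eq_zero_iff_of_nonneg hterm).1 h1.2
      have h3 : ∀ i ∈ Finset.Iio (midIndex n), w i = 0 ∧ w i.rev = 0 := by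
        intro i hi
        have h4 := (add_eq_zero_iff_of_nonneg (sq_nonneg _)
          (div_nonneg (sq_nonneg _) (hpos _).le)).1 (h2 i hi)
        have h5 : w i = 0 := by simpa using h4.1
        refine ⟨h5, ?_⟩
        simpa [h5, (hpos _).ne'] using h4.2
      have h6 : ∑ i, w i ^ 2 = 0 := by
        rw [sum_eq_mid_add_sum_pairs hodd, h1.1, zero_add]
        refine Finset.sum_eq_zero fun i hi => ?_
        simp [h3 i hi]
      ext i
      simpa using (Finset.sum_eq_zero_iff_of_nonneg (fun i _ => sq_nonneg (w i))).1 h6 i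
        (Finset.mem_univ i)
  · have h1 : ContDiff ℝ r fun x : RSpace n => α (x (midIndex n)) := by
      refine hs.comp ?_
      exact (EuclideanSpace.proj (𝕜 := ℝ) (midIndex n)).contDiff
    have h2 : ContDiff ℝ r fun x : RSpace n => (1 - α (x (midIndex n)) ^ 2)⁻¹ :=
      (contDiff_const.sub (h1.pow 2)).inv fun x => (hpos _).ne'
    simp only [fun x => dualMetric_eq hodd x (hα (x (midIndex n))), Matrix.of_apply]
    split_ifs
    · exact contDiff_const
    · exact h2
    · exact h1.neg.mul h2
    · exact contDiff_const

/-! ### Riemannian distance -/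

/-- The Riemannian distance with values in `[0, ∞]`. -/
noncomputable def metricEDist {n : ℕ} (g : RSpace n → Matrix (Fin n) (Fin n) ℝ) (x y : RSpace n) :
    ℝ≥0∞ :=
  letI : ∀ z : RSpace n, ENorm (TangentSpace 𝓘(ℝ, RSpace n) z) := tangentENorm g
  Manifold.riemannianEDist 𝓘(ℝ, RSpace n) x y

theorem metricDist_eq_toReal {n : ℕ} (g : RSpace n → Matrix (Fin n) (Fin n) ℝ) (x y : RSpace n) :
    metricDist g x y = (metricEDist g x y).toReal := rfl

theorem enormSMulClass_tangentENorm {n : ℕ} (g : RSpace n → Matrix (Fin n) (Fin n) ℝ)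
    (z : RSpace n) :
    letI : ENorm (TangentSpace 𝓘(ℝ, RSpace n) z) := tangentENorm g z
    ENormSMulClass ℝ (TangentSpace 𝓘(ℝ, RSpace n) z) := by
  let _ : ENorm (TangentSpace 𝓘(ℝ, RSpace n) z) := tangentENorm g z
  refine ⟨fun c v => ?_⟩
  change RSpace n at v
  change ENNReal.ofReal (Real.sqrt (∑ j, ∑ k, g z j k * (c • v) j * (c • v) k)) =
    ‖c‖ₑ * ENNReal.ofReal (Real.sqrt (∑ j, ∑ k, g z j k * v j * v k))
  rw [← ofReal_norm, ← ENNReal.ofReal_mul (norm_nonneg _), Real.norm_eq_abs,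
    ← Real.sqrt_sq_eq_abs, ← Real.sqrt_mul (sq_nonneg _), Finset.mul_sum]
  congr 2
  refine Finset.sum_congr rfl fun j _ => ?_
  rw [Finset.mul_sum]
  refine Finset.sum_congr rfl fun k _ => ?_
  simp only [PiLp.smul_apply, smul_eq_mul]
  ring

theorem metricEDist_comm {n : ℕ} (g : RSpace n → Matrix (Fin n) (Fin n) ℝ) (x y : RSpace n) :
    metricEDist g x y = metricEDist g y x := by
  let _ : ∀ z : RSpace n, ENorm (TangentSpace 𝓘(ℝ, RSpace n) z) := tangentENorm g
  have : ∀ z : RSpace n, ENormSMulClass ℝ (TangentSpace 𝓘(ℝ, RSpace n) z) :=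
    enormSMulClass_tangentENorm g
  exact Manifold.riemannianEDist_comm

theorem metricEDist_triangle {n : ℕ} (g : RSpace n → Matrix (Fin n) (Fin n) ℝ)
    (x y z : RSpace n) : metricEDist g x z ≤ metricEDist g x y + metricEDist g y z := by
  let _ : ∀ z : RSpace n, ENorm (TangentSpace 𝓘(ℝ, RSpace n) z) := tangentENorm g
  have : ∀ z : RSpace n, ENormSMulClass ℝ (TangentSpace 𝓘(ℝ, RSpace n) z) :=
    enormSMulClass_tangentENorm g
  exact Manifold.riemannianEDist_triangle

theorem enorm_mfderiv_tangentENorm {n : ℕ} (g : RSpace n → Matrix (Fin n) (Fin n) ℝ)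
    (γ : ℝ → RSpace n) (t : ℝ) :
    letI : ∀ z : RSpace n, ENorm (TangentSpace 𝓘(ℝ, RSpace n) z) := tangentENorm g
    ‖mfderiv 𝓘(ℝ, ℝ) 𝓘(ℝ, RSpace n) γ t 1‖ₑ =
      ENNReal.ofReal (Real.sqrt (∑ j, ∑ k, g (γ t) j k * deriv γ t j * deriv γ t k)) := by
  rw [mfderiv_eq_fderiv]
  change ENNReal.ofReal (Real.sqrt (∑ j, ∑ k, g (γ t) j k * (fderiv ℝ γ t 1 : RSpace n) j *
    (fderiv ℝ γ t 1 : RSpace n) k)) = _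
  rw [fderiv_apply_one_eq_deriv]

/-- A path of speed at most `M` bounds the distance of its endpoints from above. -/
theorem metricEDist_le_of_speed_le {n : ℕ} (g : RSpace n → Matrix (Fin n) (Fin n) ℝ)
    {γ γ' : ℝ → RSpace n} {a b M : ℝ} (hγ : ∀ t, HasDerivAt γ (γ' t) t) (hγ' : Continuous γ')
    (hab : a ≤ b) (hM : 0 ≤ M)
    (h : ∀ t ∈ Set.Icc a b, ∑ j, ∑ k, g (γ t) j k * γ' t j * γ' t k ≤ M ^ 2) :
    metricEDist g (γ a) (γ b) ≤ ENNReal.ofReal (M * (b - a)) := by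
  let _ : ∀ z : RSpace n, ENorm (TangentSpace 𝓘(ℝ, RSpace n) z) := tangentENorm g
  have : ∀ z : RSpace n, ENormSMulClass ℝ (TangentSpace 𝓘(ℝ, RSpace n) z) :=
    enormSMulClass_tangentENorm g
  have hderiv : deriv γ = γ' := funext fun t => (hγ t).deriv
  have hC : ContDiff ℝ 1 γ := by
    rw [contDiff_one_iff_deriv]
    exact ⟨fun t => (hγ t).differentiableAt, by rwa [hderiv]⟩
  have h1 : metricEDist g (γ a) (γ b) ≤ Manifold.pathELength 𝓘(ℝ, RSpace n) γ a b :=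
    Manifold.riemannianEDist_le_pathELength hC.contMDiff.contMDiffOn rfl rfl hab
  refine h1.trans ?_
  rw [Manifold.pathELength_eq_lintegral_mfderiv_Icc]
  calc ∫⁻ t in Set.Icc a b, ‖mfderiv 𝓘(ℝ, ℝ) 𝓘(ℝ, RSpace n) γ t 1‖ₑ
      ≤ ∫⁻ _ in Set.Icc a b, ENNReal.ofReal M := by
        refine setLIntegral_mono' measurableSet_Icc fun t ht => ?_
        rw [enorm_mfderiv_tangentENorm, hderiv]
        exact ENNReal.ofReal_le_ofReal (Real.sqrt_le_iff.2 ⟨hM, h t ht⟩)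
    _ = ENNReal.ofReal (M * (b - a)) := by
        rw [setLIntegral_const, Real.volume_Icc, ENNReal.ofReal_mul hM]

/-- Calibration: a linear functional of dual norm at most one everywhere bounds the distance from
below. -/
theorem ofReal_calibration_le_metricEDist {n : ℕ} (g : RSpace n → Matrix (Fin n) (Fin n) ℝ)
    (L : RSpace n →L[ℝ] ℝ) (hL : ∀ z w, L w ^ 2 ≤ ∑ j, ∑ k, g z j k * w j * w k)
    (x y : RSpace n) : ENNReal.ofReal (L (y - x)) ≤ metricEDist g x y := by
  let _ : ∀ z : RSpace n, ENorm (TangentSpace 𝓘(ℝ, RSpace n) z) := tangentENorm g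
  have : ∀ z : RSpace n, ENormSMulClass ℝ (TangentSpace 𝓘(ℝ, RSpace n) z) :=
    enormSMulClass_tangentENorm g
  refine le_of_forall_gt fun r hr => ?_
  obtain ⟨γ, h0, h1, hγ, hlen, -, -⟩ :=
    Manifold.exists_lt_locally_constant_of_riemannianEDist_lt
      (I := 𝓘(ℝ, RSpace n)) (x := x) (y := y) hr zero_lt_one
  refine lt_of_le_of_lt ?_ hlen
  have hC : ContDiff ℝ 1 γ := hγ.contDiff
  have hd : Continuous (deriv γ) := (contDiff_one_iff_deriv.1 hC).2
  have hint : ∫ t in (0 : ℝ)..1, L (deriv γ t) = L (y - x) := by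
    rw [intervalIntegral.integral_eq_sub_of_hasDerivAt (f := fun t => L (γ t)), h0, h1, map_sub]
    · intro t _
      exact L.hasFDerivAt.comp_hasDerivAt t
        ((hC.differentiable one_ne_zero) t).hasDerivAt
    · exact (L.continuous.comp hd).intervalIntegrable _ _
  rw [← hint, intervalIntegral.integral_of_le zero_le_one, ← integral_Icc_eq_integral_Ioc,
    Manifold.pathELength_eq_lintegral_mfderiv_Icc]
  refine (ENNReal.ofReal_le_ofReal (le_abs_self _)).trans ?_
  rw [← Real.norm_eq_abs, ofReal_norm]
  refine (enorm_integral_le_lintegral_enorm _).trans (lintegral_mono fun t => ?_)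
  rw [enorm_mfderiv_tangentENorm, ← ofReal_norm, Real.norm_eq_abs]
  exact ENNReal.ofReal_le_ofReal (Real.abs_le_sqrt (hL _ _))

theorem metricDist_comm {n : ℕ} (g : RSpace n → Matrix (Fin n) (Fin n) ℝ) (x y : RSpace n) :
    metricDist g x y = metricDist g y x := by
  rw [metricDist_eq_toReal, metricDist_eq_toReal, metricEDist_comm]

theorem abs_apply_le_norm {n : ℕ} (w : RSpace n) (i : Fin n) : |w i| ≤ ‖w‖ := by
  simpa using PiLp.norm_apply_le w i

/-! ### Continuity of the distance -/

section

variable {n : ℕ} [NeZero n]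

theorem sq_norm_eq_mid_add_sum_pairs (hodd : Odd n) (w : RSpace n) :
    ‖w‖ ^ 2 = w (midIndex n) ^ 2 +
      ∑ i ∈ Finset.Iio (midIndex n), (w i ^ 2 + w i.rev ^ 2) := by
  rw [EuclideanSpace.norm_sq_eq, sum_eq_mid_add_sum_pairs hodd]
  simp

theorem exists_metricEDist_le_mul_norm (hodd : Odd n) {α : ℝ → ℝ} (hα : ∀ s, |α s| < 1)
    (hc : Continuous α) (R : ℝ) : ∃ K : ℝ, 0 ≤ K ∧ ∀ x y : RSpace n, ‖x‖ ≤ R → ‖y‖ ≤ R →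
      metricEDist (dualMetric n α) x y ≤ ENNReal.ofReal (K * ‖y - x‖) := by
  have hpos : ∀ s, 0 < 1 - α s ^ 2 := fun s => by
    have := (sq_lt_one_iff_abs_lt_one _).2 (hα s)
    linarith
  obtain ⟨K₀, hK₀⟩ := (isCompact_Icc (a := -R) (b := R)).exists_bound_of_continuousOn
    (f := fun s => (1 - α s ^ 2)⁻¹)
    ((continuous_const.sub (hc.pow 2)).inv₀ fun s => (hpos s).ne').continuousOn
  refine ⟨Real.sqrt (1 + 2 * |K₀|), Real.sqrt_nonneg _, fun x y hx hy => ?_⟩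
  have hquad : ∀ z w : RSpace n, ‖z‖ ≤ R → ∑ j, ∑ k, dualMetric n α z j k * w j * w k ≤
      (1 + 2 * |K₀|) * ‖w‖ ^ 2 := by
    intro z w hz
    rw [dualMetric_quadForm hodd z (hα _), sq_norm_eq_mid_add_sum_pairs hodd]
    set a := α (z (midIndex n)) with ha
    have h1 : (1 - a ^ 2)⁻¹ ≤ |K₀| := by
      have := hK₀ (z (midIndex n)) (abs_le.1 ((abs_apply_le_norm z _).trans hz))
      exact (le_abs_self _).trans (this.trans (le_abs_self _))
    have ha1 : a ^ 2 < 1 := (sq_lt_one_iff_abs_lt_one _).2 (hα _)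
    rw [mul_add, Finset.mul_sum]
    refine add_le_add ?_ (Finset.sum_le_sum fun i _ => ?_)
    · nlinarith [sq_nonneg (w (midIndex n)), abs_nonneg K₀]
    · have h2 : (w i.rev - a * w i) ^ 2 ≤ 2 * (w i ^ 2 + w i.rev ^ 2) := by
        nlinarith [sq_nonneg (w i.rev + a * w i), sq_nonneg (w i)]
      have h3 : (w i.rev - a * w i) ^ 2 / (1 - a ^ 2) ≤ 2 * (w i ^ 2 + w i.rev ^ 2) * |K₀| := by
        rw [div_eq_mul_inv]
        exact mul_le_mul h2 h1 (inv_nonneg.2 (by linarith)) (by positivity)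
      nlinarith [sq_nonneg (w i), sq_nonneg (w i.rev)]
  have key := metricEDist_le_of_speed_le (dualMetric n α) (γ := fun t : ℝ => x + t • (y - x))
    (γ' := fun _ => y - x) (a := 0) (b := 1) (M := Real.sqrt (1 + 2 * |K₀|) * ‖y - x‖)
    (fun t => by simpa using ((hasDerivAt_id t).smul_const (y - x)).const_add x)
    continuous_const zero_le_one (by positivity) (fun t ht => by
      rw [mul_pow, Real.sq_sqrt (by positivity)]
      refine hquad _ _ ?_
      have : x + t • (y - x) ∈ Metric.closedBall (0 : RSpace n) R :=
        (convex_closedBall 0 R).add_smul_sub_mem (by simpa using hx) (by simpa using hy) ht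
      simpa using this)
  simpa using key

theorem metricEDist_ne_top (hodd : Odd n) {α : ℝ → ℝ} (hα : ∀ s, |α s| < 1)
    (hc : Continuous α) (x y : RSpace n) : metricEDist (dualMetric n α) x y ≠ ⊤ := by
  obtain ⟨K, -, hK⟩ := exists_metricEDist_le_mul_norm hodd hα hc (max ‖x‖ ‖y‖)
  exact ne_top_of_le_ne_top ENNReal.ofReal_ne_top (hK x y (le_max_left _ _) (le_max_right _ _))

theorem metricDist_triangle (hodd : Odd n) {α : ℝ → ℝ} (hα : ∀ s, |α s| < 1)
    (hc : Continuous α) (x y z : RSpace n) : metricDist (dualMetric n α) x z ≤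
      metricDist (dualMetric n α) x y + metricDist (dualMetric n α) y z := by
  have hfin := metricEDist_ne_top hodd hα hc
  simp only [metricDist_eq_toReal]
  rw [← ENNReal.toReal_add (hfin _ _) (hfin _ _)]
  exact ENNReal.toReal_mono (ENNReal.add_ne_top.2 ⟨hfin _ _, hfin _ _⟩)
    (metricEDist_triangle _ _ _ _)

theorem continuous_metricDist (hodd : Odd n) {α : ℝ → ℝ} (hα : ∀ s, |α s| < 1)
    (hc : Continuous α) :
    Continuous fun z : RSpace n × RSpace n => metricDist (dualMetric n α) z.1 z.2 := by
  rw [continuous_iff_continuousAt]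
  rintro ⟨x₀, y₀⟩
  obtain ⟨K, hK0, hK⟩ := exists_metricEDist_le_mul_norm hodd hα hc (‖x₀‖ + ‖y₀‖ + 1)
  have hloc : ∀ x y : RSpace n, ‖x‖ ≤ ‖x₀‖ + ‖y₀‖ + 1 → ‖y‖ ≤ ‖x₀‖ + ‖y₀‖ + 1 →
      metricDist (dualMetric n α) x y ≤ K * ‖y - x‖ := fun x y hx hy => by
    rw [metricDist_eq_toReal]
    exact ENNReal.toReal_le_of_le_ofReal (by positivity) (hK x y hx hy)
  have hlim : Tendsto (fun z : RSpace n × RSpace n => K * ‖z.1 - x₀‖ + K * ‖z.2 - y₀‖)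
      (𝓝 (x₀, y₀)) (𝓝 0) := by
    have : Continuous fun z : RSpace n × RSpace n => K * ‖z.1 - x₀‖ + K * ‖z.2 - y₀‖ := by
      fun_prop
    simpa using this.tendsto (x₀, y₀)
  rw [ContinuousAt, tendsto_iff_dist_tendsto_zero]
  refine squeeze_zero' (Eventually.of_forall fun z => dist_nonneg) ?_ hlim
  filter_upwards [Metric.ball_mem_nhds (x₀, y₀) one_pos] with z hz
  rw [Metric.mem_ball, Prod.dist_eq, max_lt_iff] at hz
  have hz1 : ‖z.1‖ ≤ ‖x₀‖ + ‖y₀‖ + 1 := by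
    have := norm_le_norm_add_norm_sub' z.1 x₀
    rw [← dist_eq_norm] at this
    linarith [norm_nonneg y₀, hz.1]
  have hz2 : ‖z.2‖ ≤ ‖x₀‖ + ‖y₀‖ + 1 := by
    have := norm_le_norm_add_norm_sub' z.2 y₀
    rw [← dist_eq_norm] at this
    linarith [norm_nonneg x₀, hz.2]
  have hx0 : ‖x₀‖ ≤ ‖x₀‖ + ‖y₀‖ + 1 := by linarith [norm_nonneg y₀]
  have hy0 : ‖y₀‖ ≤ ‖x₀‖ + ‖y₀‖ + 1 := by linarith [norm_nonneg x₀]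
  have tri := metricDist_triangle hodd hα hc
  have comm := metricDist_comm (dualMetric n α)
  rw [Real.dist_eq, abs_le]
  have a1 := hloc x₀ z.1 hx0 hz1
  have a2 := hloc y₀ z.2 hy0 hz2
  have t1 := tri z.1 x₀ z.2
  have t2 := tri x₀ y₀ z.2
  have t3 := tri x₀ z.1 y₀
  have t4 := tri z.1 z.2 y₀
  rw [comm z.1 x₀] at t1
  rw [comm z.2 y₀] at t4
  constructor <;> linarith

end

/-! ### The distance along a tube of geodesics -/

section

variable {n : ℕ} [NeZero n]

/-- The covector `(ξ, τ) = (ϑ, 1) / |(ϑ, 1)|`, paired with the first half of the coordinates and the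
middle one; only the entries `ϑ i` with `i` below the middle index matter. As a function on `ℝⁿ` it
solves the eikonal equation of `dualMetric n α` for every `α`. -/
noncomputable def slopeFunctional (n : ℕ) [NeZero n] (ϑ : Fin n → ℝ) : RSpace n →L[ℝ] ℝ :=
  (Real.sqrt (1 + ∑ i ∈ Finset.Iio (midIndex n), ϑ i ^ 2))⁻¹ •
    (EuclideanSpace.proj (𝕜 := ℝ) (midIndex n) +
      ∑ i ∈ Finset.Iio (midIndex n), ϑ i • EuclideanSpace.proj (𝕜 := ℝ) i)

theorem slopeFunctional_apply (ϑ : Fin n → ℝ) (w : RSpace n) :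
    slopeFunctional n ϑ w = (Real.sqrt (1 + ∑ i ∈ Finset.Iio (midIndex n), ϑ i ^ 2))⁻¹ *
      (w (midIndex n) + ∑ i ∈ Finset.Iio (midIndex n), ϑ i * w i) := by
  simp [slopeFunctional, mul_add]

theorem slopeFunctional_sq_le (hodd : Odd n) {α : ℝ → ℝ} (hα : ∀ s, |α s| < 1) (ϑ : Fin n → ℝ)
    (z w : RSpace n) :
    slopeFunctional n ϑ w ^ 2 ≤ ∑ j, ∑ k, dualMetric n α z j k * w j * w k := by
  rw [dualMetric_quadForm hodd z (hα _), slopeFunctional_apply]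
  set P := ∑ i ∈ Finset.Iio (midIndex n), ϑ i ^ 2 with hP
  set S := ∑ i ∈ Finset.Iio (midIndex n), ϑ i * w i with hS
  set Q := ∑ i ∈ Finset.Iio (midIndex n), w i ^ 2 with hQ
  have hP0 : 0 ≤ P := Finset.sum_nonneg fun i _ => sq_nonneg _
  have hQ0 : 0 ≤ Q := Finset.sum_nonneg fun i _ => sq_nonneg _
  have hCS : S ^ 2 ≤ P * Q := Finset.sum_mul_sq_le_sq_mul_sq _ _ _
  have hQle : Q ≤ ∑ i ∈ Finset.Iio (midIndex n), (w i ^ 2 +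
        (w i.rev - α (z (midIndex n)) * w i) ^ 2 / (1 - α (z (midIndex n)) ^ 2)) := by
    refine Finset.sum_le_sum fun i _ => le_add_of_nonneg_right (div_nonneg (sq_nonneg _) ?_)
    have := (sq_lt_one_iff_abs_lt_one _).2 (hα (z (midIndex n)))
    linarith
  refine le_trans ?_ (add_le_add_right hQle _)
  set b := w (midIndex n)
  rw [mul_pow, inv_pow, Real.sq_sqrt (by linarith), inv_mul_le_iff₀ (by linarith)]
  have h2 : 2 * b * S ≤ Q + P * b ^ 2 := by
    refine le_of_sq_le_sq ?_ (by positivity)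
    nlinarith [sq_nonneg (Q - P * b ^ 2), mul_le_mul_of_nonneg_left hCS (sq_nonneg b)]
  nlinarith

theorem slopeFunctional_le_metricDist (hodd : Odd n) {α : ℝ → ℝ} (hα : ∀ s, |α s| < 1)
    (hc : Continuous α) (ϑ : Fin n → ℝ) (x y : RSpace n) :
    slopeFunctional n ϑ (x - y) ≤ metricDist (dualMetric n α) x y := by
  rw [metricDist_comm, metricDist_eq_toReal]
  exact (ENNReal.ofReal_le_iff_le_toReal (metricEDist_ne_top hodd hα hc y x)).1
    (ofReal_calibration_le_metricEDist _ _ (slopeFunctional_sq_le hodd hα ϑ) y x)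

/-- A path with the momentum of a straight line in the first half of the coordinates shows that the
distance exceeds a Euclidean distance only by the square of the defect `e`. -/
theorem metricDist_le_sqrt (hodd : Odd n) {α : ℝ → ℝ} (hα : ∀ s, |α s| < 1)
    (hc : Continuous α) {K : ℝ} (x y : RSpace n) (hxy : y (midIndex n) < x (midIndex n))
    (hK : ∀ s ∈ Set.Icc (y (midIndex n)) (x (midIndex n)), (1 - α s ^ 2)⁻¹ ≤ K)
    (ν e : Fin n → ℝ)
    (hν : ∀ i ∈ Finset.Iio (midIndex n), x i - y i = (x (midIndex n) - y (midIndex n)) * ν i)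
    (he : ∀ i ∈ Finset.Iio (midIndex n), x i.rev - y i.rev =
      ν i * (∫ s in (y (midIndex n))..(x (midIndex n)), α s) +
        (x (midIndex n) - y (midIndex n)) * e i) :
    metricDist (dualMetric n α) x y ≤
      Real.sqrt (1 + ∑ i ∈ Finset.Iio (midIndex n), (ν i ^ 2 + K * e i ^ 2)) *
        (x (midIndex n) - y (midIndex n)) := by
  have hrev := rev_midIndex n hodd
  set s := y (midIndex n) with hs
  set t := x (midIndex n) with ht
  let γ : ℝ → RSpace n := fun u => WithLp.toLp 2 fun i =>
    if i = midIndex n then u else if i < midIndex n then y i + (u - s) * ν i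
    else y i + (ν i.rev * (∫ v in s..u, α v) + (u - s) * e i.rev)
  let γ' : ℝ → RSpace n := fun u => WithLp.toLp 2 fun i =>
    if i = midIndex n then 1 else if i < midIndex n then ν i
    else ν i.rev * α u + e i.rev
  have hγ : ∀ u, HasDerivAt γ (γ' u) u := by
    intro u
    suffices hpi : HasDerivAt (fun u i => γ u i) (fun i => γ' u i) u from
      (PiLp.hasFDerivAt_toLp (𝕜 := ℝ) 2 (fun i => γ u i)).comp_hasDerivAt u hpi
    refine hasDerivAt_pi.2 fun i => ?_
    simp only [γ, γ']
    split_ifs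
    · exact hasDerivAt_id u
    · simpa using (((hasDerivAt_id u).sub_const s).mul_const (ν i)).const_add (y i)
    · have h1 : HasDerivAt (fun u => ∫ v in s..u, α v) (α u) u :=
        intervalIntegral.integral_hasDerivAt_right (hc.intervalIntegrable _ _)
          (hc.stronglyMeasurableAtFilter _ _) hc.continuousAt
      simpa using ((h1.const_mul (ν i.rev)).add
        (((hasDerivAt_id u).sub_const s).mul_const (e i.rev))).const_add (y i)
  have hγ' : Continuous γ' := by
    refine (PiLp.continuous_toLp 2 _).comp (continuous_pi fun i => ?_)
    split_ifs
    · exact continuous_const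
    · exact continuous_const
    · fun_prop
  have hγs : γ s = y := by
    ext i
    simp only [γ]
    split_ifs with h1 h2
    · rw [h1]
    · simp
    · simp
  have hγt : γ t = x := by
    ext i
    simp only [γ]
    split_ifs with h1 h2
    · rw [h1]
    · linarith [hν i (Finset.mem_Iio.2 h2)]
    · have h3 : i.rev ∈ Finset.Iio (midIndex n) := by
        rw [Finset.mem_Iio, ← hrev]
        exact Fin.rev_lt_rev.2 (lt_of_le_of_ne (not_lt.1 h2) (Ne.symm h1))
      have := he _ h3
      rw [Fin.rev_rev] at this
      linarith
  have key := metricEDist_le_of_speed_le (dualMetric n α) hγ hγ' hxy.le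
    (M := Real.sqrt (1 + ∑ i ∈ Finset.Iio (midIndex n), (ν i ^ 2 + K * e i ^ 2)))
    (Real.sqrt_nonneg _) (fun u hu => by
      have hpos : 0 < 1 - α u ^ 2 := by
        have := (sq_lt_one_iff_abs_lt_one _).2 (hα u)
        linarith
      have hK0 : 0 ≤ K := (inv_nonneg.2 hpos.le).trans (hK u hu)
      have hmid : γ u (midIndex n) = u := by simp [γ]
      rw [Real.sq_sqrt (add_nonneg zero_le_one (Finset.sum_nonneg fun i _ => by positivity)),
        dualMetric_quadForm hodd _ (hα _), hmid]
      refine add_le_add (by simp [γ']) (Finset.sum_le_sum fun i hi => ?_)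
      rw [Finset.mem_Iio] at hi
      have hi' : midIndex n < i.rev := by rw [← hrev]; exact Fin.rev_lt_rev.2 hi
      have e1 : γ' u i = ν i := by simp [γ', hi.ne, hi]
      have e2 : γ' u i.rev = ν i * α u + e i := by
        simp [γ', hi'.ne', hi'.not_gt]
      rw [e1, e2, show ν i * α u + e i - α u * ν i = e i by ring, div_eq_inv_mul]
      exact add_le_add_right (mul_le_mul_of_nonneg_right (hK u hu) (sq_nonneg _)) _)
  rw [hγs, hγt] at key
  rw [metricDist_comm, metricDist_eq_toReal]
  exact ENNReal.toReal_le_of_le_ofReal (mul_nonneg (Real.sqrt_nonneg _) (by linarith)) key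

/-- If `x` and `y` lie within `ρ` of one geodesic of slope `ϑ`, at heights near `0` and `-1`, then
the distance is the linear functional `slopeFunctional n ϑ` up to an error of order `ρ ^ 2`. -/
theorem metricDist_sub_slopeFunctional_le (hodd : Odd n) {α : ℝ → ℝ} (hα : ∀ s, |α s| < 1)
    (hc : Continuous α) {K ρ : ℝ} (ϑ : Fin n → ℝ) (x y : RSpace n)
    (hx0 : 0 ≤ x (midIndex n)) (hy0 : y (midIndex n) ≤ -(3 / 4))
    (hK : ∀ s ∈ Set.Icc (y (midIndex n)) (x (midIndex n)), (1 - α s ^ 2)⁻¹ ≤ K)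
    (hρm : (Finset.Iio (midIndex n)).card * ρ ^ 2 ≤ 1 / 16)
    (h1 : ∀ i ∈ Finset.Iio (midIndex n),
      |x i - y i - (x (midIndex n) - y (midIndex n)) * ϑ i| ≤ ρ)
    (h2 : ∀ i ∈ Finset.Iio (midIndex n), |x i.rev - y i.rev -
      ϑ i * (∫ s in (y (midIndex n))..(x (midIndex n)), α s)| ≤ ρ) :
    metricDist (dualMetric n α) x y - slopeFunctional n ϑ (x - y) ≤
      (Finset.Iio (midIndex n)).card * ((1 + 4 * K) * ρ ^ 2) := by
  set s := y (midIndex n) with hs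
  set t := x (midIndex n) with ht
  set T := t - s with hT
  set I := ∫ s in s..t, α s with hI
  have hT0 : 3 / 4 ≤ T := by linarith
  have hTpos : 0 < T := by linarith
  have hIT : |I| ≤ T := by
    have := intervalIntegral.norm_integral_le_of_norm_le_const (a := s) (b := t) (C := 1) (f := α)
      (fun u _ => (hα u).le)
    rwa [one_mul, Real.norm_eq_abs, abs_of_pos (show 0 < t - s from hTpos)] at this
  have hK1 : 0 ≤ K := le_trans (inv_nonneg.2 (by
    have := (sq_lt_one_iff_abs_lt_one _).2 (hα s)
    linarith)) (hK s ⟨le_rfl, by linarith⟩)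
  let η : Fin n → ℝ := fun i => x i - y i - T * ϑ i
  let ν : Fin n → ℝ := fun i => (x i - y i) / T
  let e : Fin n → ℝ := fun i => (x i.rev - y i.rev - ν i * I) / T
  have hup := metricDist_le_sqrt hodd hα hc x y (by linarith) hK ν e
    (fun i _ => by
      rw [← ht, ← hs, ← hT]
      simp only [ν]
      field_simp)
    (fun i _ => by
      rw [← hI, ← ht, ← hs, ← hT]
      simp only [e]
      field_simp
      ring)
  rw [← ht, ← hs, ← hT] at hup
  -- the functional at `x - y`, and its comparison with the Euclidean length of `(x - y)`
  set P := ∑ i ∈ Finset.Iio (midIndex n), ϑ i ^ 2 with hP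
  set S := ∑ i ∈ Finset.Iio (midIndex n), ϑ i * η i with hS
  set Q := ∑ i ∈ Finset.Iio (midIndex n), η i ^ 2 with hQ
  have hP0 : 0 ≤ P := Finset.sum_nonneg fun i _ => sq_nonneg _
  have hQ0 : 0 ≤ Q := Finset.sum_nonneg fun i _ => sq_nonneg _
  have hCS : S ^ 2 ≤ P * Q := Finset.sum_mul_sq_le_sq_mul_sq _ _ _
  have hQρ : Q ≤ (Finset.Iio (midIndex n)).card * ρ ^ 2 := by
    rw [← nsmul_eq_mul]
    refine Finset.sum_le_card_nsmul _ _ _ fun i hi => ?_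
    exact sq_le_sq' (abs_le.1 (h1 i hi)).1 (abs_le.1 (h1 i hi)).2
  set W := Real.sqrt (1 + P) with hW
  have hW2 : W ^ 2 = 1 + P := Real.sq_sqrt (by linarith)
  have hW1 : 1 ≤ W := by
    rw [hW, Real.one_le_sqrt]
    linarith
  set ℓ := slopeFunctional n ϑ (x - y) with hℓ
  have hℓeq : ℓ * W = T * W ^ 2 + S := by
    rw [hℓ, slopeFunctional_apply, ← hP, ← hW]
    have : ∑ i ∈ Finset.Iio (midIndex n), ϑ i * (x - y) i = T * P + S := by
      rw [hP, hS, Finset.mul_sum, ← Finset.sum_add_distrib]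
      refine Finset.sum_congr rfl fun i _ => ?_
      simp only [PiLp.sub_apply, η]
      ring
    rw [this, PiLp.sub_apply, ← ht, ← hs, ← hT, hW2]
    field_simp
    ring
  have hSabs : |S| ≤ W / 4 := by
    refine abs_le_of_sq_le_sq ?_ (by linarith)
    have h3 : P * Q ≤ P * (1 / 16) := mul_le_mul_of_nonneg_left (hQρ.trans hρm) hP0
    rw [div_pow, hW2]
    linarith
  have hℓ2 : 1 / 2 ≤ ℓ := by
    have h3 : (T * W ^ 2 + S) / W = ℓ := by rw [← hℓeq]; field_simp
    rw [← h3, le_div_iff₀ (by linarith)]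
    have h4 : 1 * W ≤ W * W := mul_le_mul_of_nonneg_right hW1 (by linarith)
    have h5 : 3 / 4 * W ^ 2 ≤ T * W ^ 2 := mul_le_mul_of_nonneg_right hT0 (sq_nonneg W)
    linarith [neg_abs_le S, sq W]
  have hlen : T ^ 2 * (1 + ∑ i ∈ Finset.Iio (midIndex n), ν i ^ 2) ≤ ℓ ^ 2 + Q := by
    have h3 : T ^ 2 * ∑ i ∈ Finset.Iio (midIndex n), ν i ^ 2 = T ^ 2 * P + 2 * T * S + Q := by
      rw [hP, hS, hQ, Finset.mul_sum, Finset.mul_sum, Finset.mul_sum, ← Finset.sum_add_distrib,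
        ← Finset.sum_add_distrib]
      refine Finset.sum_congr rfl fun i _ => ?_
      simp only [ν, η]
      field_simp
      ring
    have h4 : (ℓ * W) ^ 2 = (T * W ^ 2 + S) ^ 2 := by rw [hℓeq]
    have h5 : T ^ 2 * W ^ 2 + 2 * T * S ≤ ℓ ^ 2 := by
      refine le_of_mul_le_mul_right ?_ (show 0 < W ^ 2 by positivity)
      have h6 : (T ^ 2 * W ^ 2 + 2 * T * S) * W ^ 2 = (T * W ^ 2 + S) ^ 2 - S ^ 2 := by ring
      rw [h6, ← h4, mul_pow]
      linarith [sq_nonneg S]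
    rw [mul_add, h3]
    rw [hW2] at h5
    linarith
  have hebound : T ^ 2 * ∑ i ∈ Finset.Iio (midIndex n), K * e i ^ 2 ≤
      (Finset.Iio (midIndex n)).card * (4 * K * ρ ^ 2) := by
    rw [Finset.mul_sum, ← nsmul_eq_mul]
    refine Finset.sum_le_card_nsmul _ _ _ fun i hi => ?_
    have h3 : T * e i = (x i.rev - y i.rev - ϑ i * I) - η i * (I / T) := by
      simp only [e, ν, η]
      field_simp
      ring
    have h4 : |T * e i| ≤ 2 * ρ := by
      have h5 : |I / T| ≤ 1 := by
        rw [abs_div, abs_of_pos hTpos]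
        exact div_le_one_of_le₀ hIT hTpos.le
      have h6 : |η i * (I / T)| ≤ ρ := by
        rw [abs_mul]
        calc |η i| * |I / T| ≤ |η i| * 1 := mul_le_mul_of_nonneg_left h5 (abs_nonneg _)
          _ ≤ ρ := by simpa using h1 i hi
      rw [h3]
      calc _ ≤ |x i.rev - y i.rev - ϑ i * I| + |η i * (I / T)| := abs_sub _ _
        _ ≤ 2 * ρ := by linarith [h2 i hi]
    have h7 : (T * e i) ^ 2 ≤ (2 * ρ) ^ 2 :=
      sq_le_sq' (abs_le.1 h4).1 (abs_le.1 h4).2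
    calc T ^ 2 * (K * e i ^ 2) = K * (T * e i) ^ 2 := by ring
      _ ≤ K * (2 * ρ) ^ 2 := mul_le_mul_of_nonneg_left h7 hK1
      _ = 4 * K * ρ ^ 2 := by ring
  set E := (Finset.Iio (midIndex n)).card * ((1 + 4 * K) * ρ ^ 2) with hE
  have hE0 : 0 ≤ E := by positivity
  rw [Finset.sum_add_distrib] at hup
  have hV0 : 0 ≤ ∑ i ∈ Finset.Iio (midIndex n), ν i ^ 2 :=
    Finset.sum_nonneg fun i _ => sq_nonneg _
  have hH0 : 0 ≤ ∑ i ∈ Finset.Iio (midIndex n), K * e i ^ 2 :=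
    Finset.sum_nonneg fun i _ => mul_nonneg hK1 (sq_nonneg _)
  have hfin : Real.sqrt (1 + (∑ i ∈ Finset.Iio (midIndex n), ν i ^ 2 +
      ∑ i ∈ Finset.Iio (midIndex n), K * e i ^ 2)) * T ≤ ℓ + E := by
    refine le_of_sq_le_sq ?_ (by linarith)
    rw [mul_pow, Real.sq_sqrt (by linarith)]
    have h3 : E = (Finset.Iio (midIndex n)).card * ρ ^ 2 +
      (Finset.Iio (midIndex n)).card * (4 * K * ρ ^ 2) := by rw [hE]; ring
    have h4 : 1 * E ≤ 2 * ℓ * E := mul_le_mul_of_nonneg_right (by linarith) hE0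
    calc _ = T ^ 2 * (1 + ∑ i ∈ Finset.Iio (midIndex n), ν i ^ 2) +
          T ^ 2 * ∑ i ∈ Finset.Iio (midIndex n), K * e i ^ 2 := by ring
      _ ≤ ℓ ^ 2 + 1 * E := by linarith
      _ ≤ ℓ ^ 2 + 2 * ℓ * E + E ^ 2 := by linarith [sq_nonneg E]
      _ = (ℓ + E) ^ 2 := by ring
  linarith

end

/-! ### Signs without cancellation -/

theorem enorm_add_sq_add_enorm_sub_sq (a b : ℂ) :
    ‖a + b‖ₑ ^ 2 + ‖a - b‖ₑ ^ 2 = 2 * (‖a‖ₑ ^ 2 + ‖b‖ₑ ^ 2) := by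
  simp only [← ofReal_norm, ← ENNReal.ofReal_pow (norm_nonneg _)]
  rw [← ENNReal.ofReal_add (by positivity) (by positivity),
    ← ENNReal.ofReal_add (by positivity) (by positivity), ← ENNReal.ofReal_ofNat 2,
    ← ENNReal.ofReal_mul (by norm_num)]
  congr 1
  have := parallelogram_law_with_norm ℝ a b
  linarith

/-- A deterministic substitute for Khinchine's inequality in `L²`: by the parallelogram law, the
signs can be chosen one after the other so that the square norms at least add up. -/
theorem exists_signs_sum_lintegral_sq_le {X ι : Type*} [MeasurableSpace X] (μ : Measure X)
    (J : Finset ι) (z : ι → X → ℂ) (hz : ∀ j, Measurable (z j)) :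
    ∃ ε : ι → ℂ, (∀ j, ‖ε j‖ = 1) ∧
      ∑ j ∈ J, ∫⁻ x, ‖z j x‖ₑ ^ 2 ∂μ ≤ ∫⁻ x, ‖∑ j ∈ J, ε j * z j x‖ₑ ^ 2 ∂μ := by
  classical
  induction J using Finset.induction_on with
  | empty => exact ⟨fun _ => 1, by simp, by simp⟩
  | insert k J hk ih =>
    obtain ⟨ε, hε, h⟩ := ih
    have hsum : Measurable fun x => ∑ j ∈ J, ε j * z j x :=
      Finset.measurable_fun_sum _ fun j _ => (hz j).const_mul _
    set S : X → ℂ := fun x => ∑ j ∈ J, ε j * z j x with hS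
    have key : ∫⁻ x, ‖S x + z k x‖ₑ ^ 2 ∂μ + ∫⁻ x, ‖S x - z k x‖ₑ ^ 2 ∂μ =
        2 * (∫⁻ x, ‖S x‖ₑ ^ 2 ∂μ + ∫⁻ x, ‖z k x‖ₑ ^ 2 ∂μ) := by
      have m1 : Measurable fun x => ‖S x + z k x‖ₑ ^ 2 := (hsum.add (hz k)).enorm.pow_const 2
      have m2 : Measurable fun x => ‖S x‖ₑ ^ 2 := hsum.enorm.pow_const 2
      have m3 : Measurable fun x => ‖z k x‖ₑ ^ 2 := (hz k).enorm.pow_const 2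
      rw [← lintegral_add_left m1, ← lintegral_add_left m2, ← lintegral_const_mul 2 (by fun_prop)]
      exact lintegral_congr fun x => enorm_add_sq_add_enorm_sub_sq _ _
    have hsign : ∃ s : ℂ, ‖s‖ = 1 ∧ ∫⁻ x, ‖S x‖ₑ ^ 2 ∂μ + ∫⁻ x, ‖z k x‖ₑ ^ 2 ∂μ ≤
        ∫⁻ x, ‖S x + s * z k x‖ₑ ^ 2 ∂μ := by
      by_contra! hcon
      have h1 := hcon 1 (by simp)
      have h2 := hcon (-1) (by simp)
      simp only [one_mul, neg_mul, ← sub_eq_add_neg] at h1 h2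
      have h3 := ENNReal.add_lt_add h1 h2
      rw [key, two_mul] at h3
      exact lt_irrefl _ h3
    obtain ⟨s, hs, hle⟩ := hsign
    refine ⟨Function.update ε k s, fun j => ?_, ?_⟩
    · by_cases hj : j = k
      · subst hj; simpa using hs
      · simpa [hj] using hε j
    · rw [Finset.sum_insert hk, add_comm]
      refine (add_le_add_left h _).trans (hle.trans (le_of_eq ?_))
      refine lintegral_congr fun x => ?_
      rw [Finset.sum_insert hk, Function.update_self, add_comm]
      congr 3
      refine Finset.sum_congr rfl fun j hj => ?_
      rw [Function.update_of_ne (ne_of_mem_of_not_mem hj hk)]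

/-! ### Superposition of functions concentrated on tubes -/

section

variable {n : ℕ}

theorem measurable_oscOp {d a : RSpace n → RSpace n → ℝ}
    (hd : Continuous fun z : RSpace n × RSpace n => d z.1 z.2)
    (ha : Continuous fun z : RSpace n × RSpace n => a z.1 z.2) (lam : ℝ) {f : RSpace n → ℂ}
    (hf : Measurable f) : Measurable (oscOp d a lam f) := by
  have h1 : Measurable fun z : RSpace n × RSpace n =>
      Complex.exp (Complex.I * (lam * d z.1 z.2 : ℝ)) * (a z.1 z.2 : ℂ) * f z.2 := by
    refine Measurable.mul ?_ (hf.comp measurable_snd)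
    refine Continuous.measurable ?_
    fun_prop
  exact (h1.stronglyMeasurable.integral_prod_right').measurable

theorem integrable_oscOp_integrand {d a : RSpace n → RSpace n → ℝ}
    (hd : Continuous fun z : RSpace n × RSpace n => d z.1 z.2)
    (ha : Continuous fun z : RSpace n × RSpace n => a z.1 z.2) {M : ℝ}
    (hM : ∀ x y, |a x y| ≤ M) (lam : ℝ) {f : RSpace n → ℂ} (hf : Measurable f)
    (hf1 : ∀ y, ‖f y‖ ≤ 1) {R : Set (RSpace n)} (hRfin : volume R ≠ ⊤)
    (hfR : ∀ y ∉ R, f y = 0) (x : RSpace n) :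
    Integrable fun y => Complex.exp (Complex.I * (lam * d x y : ℝ)) * (a x y : ℂ) * f y := by
  have hdx : Continuous fun y => d x y := hd.comp (by fun_prop : Continuous fun y => (x, y))
  have hax : Continuous fun y => a x y := ha.comp (by fun_prop : Continuous fun y => (x, y))
  have hmeas : Measurable fun y =>
      Complex.exp (Complex.I * (lam * d x y : ℝ)) * (a x y : ℂ) * f y := by
    refine Measurable.mul (Continuous.measurable ?_) hf
    fun_prop
  have h1 : IntegrableOn (fun y =>
      Complex.exp (Complex.I * (lam * d x y : ℝ)) * (a x y : ℂ) * f y) R := by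
    refine Measure.integrableOn_of_bounded (M := M) hRfin hmeas.aestronglyMeasurable
      (Eventually.of_forall fun y => ?_)
    rw [norm_mul, norm_mul, mul_comm Complex.I, Complex.norm_exp_ofReal_mul_I, one_mul,
      Complex.norm_real, Real.norm_eq_abs]
    calc |a x y| * ‖f y‖ ≤ |a x y| * 1 := mul_le_mul_of_nonneg_left (hf1 y) (abs_nonneg _)
      _ ≤ M := by simpa using hM x y
  refine (integrableOn_iff_integrable_of_support_subset fun y hy => ?_).1 h1
  by_contra hyR
  exact hy (by simp [hfR y hyR])

theorem norm_oscOp_le {d a : RSpace n → RSpace n → ℝ} {M : ℝ} (hM : ∀ x y, |a x y| ≤ M)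
    (lam : ℝ) {f : RSpace n → ℂ} (hf1 : ∀ y, ‖f y‖ ≤ 1) {R : Set (RSpace n)}
    (hRfin : volume R ≠ ⊤) (hfR : ∀ y ∉ R, f y = 0) (x : RSpace n) :
    ‖oscOp d a lam f x‖ ≤ M * (volume R).toReal := by
  unfold oscOp
  rw [← setIntegral_eq_integral_of_forall_compl_eq_zero (s := R)
    (fun y hy => by simp [hfR y hy])]
  refine norm_setIntegral_le_of_norm_le_const (lt_top_iff_ne_top.2 hRfin) fun y _ => ?_
  rw [norm_mul, norm_mul, mul_comm Complex.I, Complex.norm_exp_ofReal_mul_I, one_mul,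
    Complex.norm_real, Real.norm_eq_abs]
  calc |a x y| * ‖f y‖ ≤ |a x y| * 1 := mul_le_mul_of_nonneg_left (hf1 y) (abs_nonneg _)
    _ ≤ M := by simpa using hM x y

/-- If the phase `lam * d` agrees up to a bounded error with that of a linear functional `L` on `T`,
then there is no cancellation when the operator acts on the plane wave `exp (i lam L)` cut off
to `T`. -/
theorem le_norm_oscOp_indicator {d a : RSpace n → RSpace n → ℝ}
    (hd : Continuous fun z : RSpace n × RSpace n => d z.1 z.2)
    (ha : Continuous fun z : RSpace n × RSpace n => a z.1 z.2) {M : ℝ}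
    (hM : ∀ x y, |a x y| ≤ M) {lam κ : ℝ} (hlam : 0 ≤ lam) (hκ : 0 ≤ κ)
    {T : Set (RSpace n)} (hT : MeasurableSet T) (hTfin : volume T ≠ ⊤) (L : RSpace n →L[ℝ] ℝ)
    (x : RSpace n) (h0 : ∀ y ∈ T, L (x - y) ≤ d x y)
    (h1 : ∀ y ∈ T, lam * (d x y - L (x - y)) ≤ 1) (hκa : ∀ y ∈ T, κ ≤ a x y) :
    κ / 2 * (volume T).toReal ≤
      ‖oscOp d a lam (T.indicator fun y => Complex.exp (Complex.I * (lam * L y : ℝ))) x‖ := by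
  have hf : Measurable (T.indicator fun y => Complex.exp (Complex.I * (lam * L y : ℝ))) := by
    refine Measurable.indicator (Continuous.measurable ?_) hT
    fun_prop
  have hf1 : ∀ y, ‖T.indicator (fun y => Complex.exp (Complex.I * (lam * L y : ℝ))) y‖ ≤ 1 := by
    intro y
    refine (norm_indicator_le_norm_self _ _).trans (le_of_eq ?_)
    rw [mul_comm Complex.I, Complex.norm_exp_ofReal_mul_I]
  have hint := integrable_oscOp_integrand hd ha hM lam hf hf1 hTfin
    (fun y hy => Set.indicator_of_notMem hy _) x
  set f := T.indicator fun y => Complex.exp (Complex.I * (lam * L y : ℝ)) with hfdef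
  have hunit : ‖Complex.exp (Complex.I * (-(lam * L x) : ℝ))‖ = 1 := by
    rw [mul_comm Complex.I, Complex.norm_exp_ofReal_mul_I]
  have heq : ‖oscOp d a lam f x‖ =
      ‖∫ y, Complex.exp (Complex.I * (-(lam * L x) : ℝ)) *
        (Complex.exp (Complex.I * (lam * d x y : ℝ)) * (a x y : ℂ) * f y)‖ := by
    rw [integral_const_mul, norm_mul, hunit, one_mul]
    rfl
  rw [heq]
  refine le_trans ?_ (Complex.re_le_norm _)
  have hint2 := hint.const_mul (Complex.exp (Complex.I * (-(lam * L x) : ℝ)))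
  have hre := integral_re hint2
  simp only [RCLike.re_to_complex] at hre
  rw [← hre]
  have hform : ∀ y ∈ T, (Complex.exp (Complex.I * (-(lam * L x) : ℝ)) *
        (Complex.exp (Complex.I * (lam * d x y : ℝ)) * (a x y : ℂ) * f y)).re =
      Real.cos (lam * (d x y - L (x - y))) * a x y := by
    intro y hy
    rw [hfdef, Set.indicator_of_mem hy]
    have : Complex.exp (Complex.I * (-(lam * L x) : ℝ)) *
        (Complex.exp (Complex.I * (lam * d x y : ℝ)) * (a x y : ℂ) *
          Complex.exp (Complex.I * (lam * L y : ℝ))) =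
        Complex.exp ((lam * (d x y - L (x - y)) : ℝ) * Complex.I) * (a x y : ℂ) := by
      rw [map_sub, show ((lam * (d x y - (L x - L y)) : ℝ) : ℂ) * Complex.I =
        Complex.I * (-(lam * L x) : ℝ) + Complex.I * (lam * d x y : ℝ) +
          Complex.I * (lam * L y : ℝ) by push_cast; ring, Complex.exp_add, Complex.exp_add]
      ring
    rw [this, Complex.re_mul_ofReal, Complex.exp_ofReal_mul_I_re]
  rw [← setIntegral_eq_integral_of_forall_compl_eq_zero (s := T)
    (fun y hy => by simp [hfdef, hy])]
  have hc : ∫ _ in T, κ / 2 = κ / 2 * (volume T).toReal := by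
    rw [setIntegral_const, smul_eq_mul, mul_comm, Measure.real]
  rw [← hc]
  refine setIntegral_mono_on (integrableOn_const hTfin) hint2.re.integrableOn hT
    fun y hy => ?_
  rw [hform y hy]
  have h2 : 0 ≤ lam * (d x y - L (x - y)) := mul_nonneg hlam (sub_nonneg.2 (h0 y hy))
  have h3 : 1 / 2 ≤ Real.cos (lam * (d x y - L (x - y))) := by
    refine le_trans ?_ (Real.one_sub_sq_div_two_le_cos)
    nlinarith [h1 y hy]
  nlinarith [hκa y hy]

/-- Decompose `R` into cells, each of which carries a plane wave that the operator sends with no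
cancellation to a set of measure at least `V` in `E`. For suitable signs, the superposition of these
waves has a large image in `L²(E)`. -/
theorem exists_bounded_le_lintegral_oscOp_sq {ι : Type*} {d a : RSpace n → RSpace n → ℝ}
    (hd : Continuous fun z : RSpace n × RSpace n => d z.1 z.2)
    (ha : Continuous fun z : RSpace n × RSpace n => a z.1 z.2) {M : ℝ}
    (hM : ∀ x y, |a x y| ≤ M) {lam κ V : ℝ} (hlam : 0 ≤ lam) (hκ : 0 ≤ κ) (hV : 0 ≤ V)
    {R E : Set (RSpace n)} (hRfin : volume R ≠ ⊤)
    (cell : RSpace n → ι) (hcell : ∀ j, MeasurableSet (R ∩ cell ⁻¹' {j}))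
    (J : Finset ι) (hJ : ∀ y ∈ R, cell y ∈ J) (L : ι → RSpace n →L[ℝ] ℝ)
    (F : ι → Set (RSpace n)) (hF : ∀ j, MeasurableSet (F j))
    (hFE : ∀ y ∈ R, F (cell y) ⊆ E)
    (hFV : ∀ y ∈ R, ENNReal.ofReal V ≤ volume (F (cell y)))
    (h0 : ∀ y ∈ R, ∀ x ∈ F (cell y), L (cell y) (x - y) ≤ d x y)
    (h1 : ∀ y ∈ R, ∀ x ∈ F (cell y), lam * (d x y - L (cell y) (x - y)) ≤ 1)
    (hκa : ∀ y ∈ R, ∀ x ∈ F (cell y), κ ≤ a x y) :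
    ∃ f : RSpace n → ℂ, Measurable f ∧ (∀ y, ‖f y‖ ≤ 1) ∧ (∀ y ∉ R, f y = 0) ∧
      ENNReal.ofReal ((κ / 2) ^ 2 * V * ((volume R).toReal ^ 2 / J.card)) ≤
        ∫⁻ x in E, ‖oscOp d a lam f x‖ₑ ^ 2 := by
  classical
  let T : ι → Set (RSpace n) := fun j => R ∩ cell ⁻¹' {j}
  have hTfin : ∀ j, volume (T j) ≠ ⊤ := fun j =>
    ne_top_of_le_ne_top hRfin (measure_mono Set.inter_subset_left)
  let w : ι → RSpace n → ℂ := fun j =>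
    (T j).indicator fun y => Complex.exp (Complex.I * (lam * L j y : ℝ))
  have hw : ∀ j, Measurable (w j) := fun j => by
    refine Measurable.indicator (Continuous.measurable ?_) (hcell j)
    fun_prop
  have hw1 : ∀ j y, ‖w j y‖ ≤ 1 := fun j y => by
    refine (norm_indicator_le_norm_self _ _).trans (le_of_eq ?_)
    rw [mul_comm Complex.I, Complex.norm_exp_ofReal_mul_I]
  have hwR : ∀ j, ∀ y ∉ R, w j y = 0 := fun j y hy =>
    Set.indicator_of_notMem (fun h => hy h.1) _
  have hwcell : ∀ j y, j ≠ cell y → w j y = 0 := fun j y hj =>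
    Set.indicator_of_notMem (fun h => hj h.2.symm) _
  obtain ⟨ε, hε, hle⟩ := exists_signs_sum_lintegral_sq_le (volume.restrict E) J
    (fun j => oscOp d a lam (w j)) (fun j => measurable_oscOp hd ha lam (hw j))
  refine ⟨fun y => ∑ j ∈ J, ε j * w j y, ?_, fun y => ?_, fun y hy => ?_, ?_⟩
  · exact Finset.measurable_fun_sum _ fun j _ => (hw j).const_mul _
  · beta_reduce
    by_cases hy : y ∈ R
    · rw [Finset.sum_eq_single (cell y) (fun j _ hj => by rw [hwcell j y hj, mul_zero])
        (fun h => absurd (hJ y hy) h), norm_mul, hε, one_mul]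
      exact hw1 _ _
    · simp [hwR _ y hy]
  · simp [hwR _ y hy]
  · have hlin : ∀ x, oscOp d a lam (fun y => ∑ j ∈ J, ε j * w j y) x =
        ∑ j ∈ J, ε j * oscOp d a lam (w j) x := by
      intro x
      unfold oscOp
      simp only [← integral_const_mul]
      rw [← integral_finsetSum]
      · refine integral_congr_ae (Eventually.of_forall fun y => ?_)
        simp only [Finset.mul_sum]
        exact Finset.sum_congr rfl fun j _ => by ring
      · intro j _
        exact (integrable_oscOp_integrand hd ha hM lam (hw j) (hw1 j) hRfin (hwR j) x).const_mul _
    simp only [hlin]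
    refine le_trans ?_ hle
    have hterm : ∀ j ∈ J, ENNReal.ofReal ((κ / 2) ^ 2 * V * (volume (T j)).toReal ^ 2) ≤
        ∫⁻ x in E, ‖oscOp d a lam (w j) x‖ₑ ^ 2 := by
      intro j _
      by_cases hne : ∃ y ∈ R, cell y = j
      · obtain ⟨y, hy, rfl⟩ := hne
        refine le_trans ?_ (lintegral_mono_set (hFE y hy))
        have hpt : ∀ x ∈ F (cell y), ENNReal.ofReal ((κ / 2 * (volume (T (cell y))).toReal) ^ 2) ≤
            ‖oscOp d a lam (w (cell y)) x‖ₑ ^ 2 := by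
          intro x hx
          rw [← ofReal_norm, ← ENNReal.ofReal_pow (norm_nonneg _)]
          refine ENNReal.ofReal_le_ofReal (pow_le_pow_left₀ (by positivity) ?_ 2)
          refine le_norm_oscOp_indicator hd ha hM hlam hκ (hcell _) (hTfin _) (L (cell y)) x
            (fun y' hy' => ?_) (fun y' hy' => ?_) (fun y' hy' => ?_)
          · have e : cell y' = cell y := hy'.2
            rw [← e] at hx ⊢
            exact h0 y' hy'.1 x hx
          · have e : cell y' = cell y := hy'.2
            rw [← e] at hx ⊢
            exact h1 y' hy'.1 x hx
          · have e : cell y' = cell y := hy'.2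
            rw [← e] at hx
            exact hκa y' hy'.1 x hx
        refine le_trans ?_ (setLIntegral_mono' (hF _) hpt)
        rw [setLIntegral_const]
        refine le_trans (le_of_eq ?_) (mul_le_mul_right (hFV y hy) _)
        rw [← ENNReal.ofReal_mul (by positivity)]
        congr 1
        ring
      · have : T j = ∅ := by
          ext y
          simp only [T, Set.mem_inter_iff, Set.mem_preimage, Set.mem_singleton_iff,
            Set.mem_empty_iff_false, iff_false]
          exact fun h => hne ⟨y, h.1, h.2⟩
        simp [this]
    refine le_trans ?_ (Finset.sum_le_sum hterm)
    rw [← ENNReal.ofReal_sum_of_nonneg fun j _ => by positivity, ← Finset.mul_sum]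
    refine ENNReal.ofReal_le_ofReal (mul_le_mul_of_nonneg_left ?_ (by positivity))
    have hsum : ∑ j ∈ J, (volume (T j)).toReal = (volume R).toReal := by
      rw [← ENNReal.toReal_sum fun j _ => hTfin j]
      congr 1
      rw [← measure_biUnion_finset _ fun j _ => hcell j]
      · congr 1
        ext y
        simp only [Set.mem_iUnion, Set.mem_inter_iff, Set.mem_preimage, Set.mem_singleton_iff,
          exists_prop]
        exact ⟨fun ⟨j, _, h, _⟩ => h, fun h => ⟨cell y, hJ y h, h, rfl⟩⟩
      · intro i _ j _ hij
        refine Set.disjoint_left.2 fun y hi hj => hij ?_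
        rw [← hi.2, ← hj.2]
    refine div_le_of_le_mul₀ (Nat.cast_nonneg _) (Finset.sum_nonneg fun j _ => sq_nonneg _) ?_
    rw [← hsum, mul_comm]
    exact sq_sum_le_card_mul_sum_sq

end

/-! ### Sheared boxes -/

section

variable {n : ℕ} [NeZero n]

/-- The box with lower corner `l` and upper corner `u`, sheared so that it follows the direction
`v` as the middle coordinate grows. -/
def shearedBox (v l u : Fin n → ℝ) : Set (RSpace n) :=
  {x | ∀ i, x i - x (midIndex n) * v i ∈ Set.Icc (l i) (u i)}

theorem measurableSet_shearedBox (v l u : Fin n → ℝ) : MeasurableSet (shearedBox v l u) := by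
  have : shearedBox v l u =
      ⋂ i, (fun x : RSpace n => x i - x (midIndex n) * v i) ⁻¹' Set.Icc (l i) (u i) := by
    ext x
    simp [shearedBox]
  rw [this]
  refine MeasurableSet.iInter fun i => measurableSet_Icc.preimage (Continuous.measurable ?_)
  fun_prop

theorem volume_shearedBox (v l u : Fin n → ℝ) (hv : v (midIndex n) = 0) :
    volume (shearedBox v l u) = ∏ i, ENNReal.ofReal (u i - l i) := by
  have hφ : (EuclideanSpace.proj (𝕜 := ℝ) (midIndex n)).toLinearMap (-WithLp.toLp 2 v) = 0 := by
    simp [hv]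
  have h1 : shearedBox v l u = LinearEquiv.transvection hφ ⁻¹'
      ((WithLp.ofLp : RSpace n → (Fin n → ℝ)) ⁻¹' Set.Icc l u) := by
    ext x
    simp only [shearedBox, Set.mem_ofPred_eq, Set.mem_preimage, Set.mem_Icc, Pi.le_def,
      LinearEquiv.transvection.apply, PiLp.add_apply, PiLp.smul_apply, PiLp.neg_apply]
    simp [sub_eq_add_neg, forall_and]
  have hdet : LinearMap.det ((LinearEquiv.transvection hφ).symm : RSpace n →ₗ[ℝ] RSpace n) = 1 := by
    rw [← LinearEquiv.coe_det, LinearEquiv.det_symm]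
    simp
  rw [h1, Measure.addHaar_preimage_linearEquiv, hdet,
    (PiLp.volume_preserving_ofLp (Fin n)).measure_preimage measurableSet_Icc.nullMeasurableSet,
    Real.volume_Icc_pi]
  simp

/-! ### Primitives of `α` -/

/-- The primitive of `α` vanishing at `0`. A geodesic of slope `v` through the hyperplane where the
second half of the coordinates vanishes at height `0` has `x_{rev i} = primitive α t * v i` at
height `t`. -/
noncomputable def primitive (α : ℝ → ℝ) (t : ℝ) : ℝ := ∫ s in (0 : ℝ)..t, α s

theorem continuous_primitive {α : ℝ → ℝ} (hc : Continuous α) : Continuous (primitive α) :=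
  intervalIntegral.continuous_primitive (fun _ _ => hc.intervalIntegrable _ _) 0

theorem integral_eq_primitive_sub {α : ℝ → ℝ} (hc : Continuous α) (s t : ℝ) :
    ∫ u in s..t, α u = primitive α t - primitive α s :=
  (intervalIntegral.integral_interval_sub_left (hc.intervalIntegrable _ _)
    (hc.intervalIntegrable _ _)).symm

theorem abs_primitive_le {α : ℝ → ℝ} (hα : ∀ s, |α s| < 1) (t : ℝ) : |primitive α t| ≤ |t| := by
  have := intervalIntegral.norm_integral_le_of_norm_le_const (a := 0) (b := t) (C := 1) (f := α)
    (fun u _ => (hα u).le)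
  simpa [primitive] using this

theorem primitive_neg_of_neg {α : ℝ → ℝ} (hc : Continuous α) (hα : ∀ s < 0, 0 < α s) {t : ℝ}
    (ht : t < 0) : primitive α t < 0 := by
  unfold primitive
  rw [intervalIntegral.integral_symm, neg_lt_zero]
  exact intervalIntegral.intervalIntegral_pos_of_pos_on (hc.intervalIntegrable _ _)
    (fun s hs => hα s hs.2) ht

/-! ### Cells of tubes -/

/-- The geodesic parameters of the point `y` in units of `r`, for geodesics that pass through the
hyperplane where the second half of the coordinates vanishes at height `0`: below the middle index,
the position at height `0`; above it, the slope. -/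
noncomputable def tubeParam (α : ℝ → ℝ) (r : ℝ) (y : RSpace n) (i : Fin n) : ℝ :=
  if i < midIndex n then
    (y i - y (midIndex n) * (y i.rev / primitive α (y (midIndex n)))) / r
  else if i = midIndex n then 0 else y i / primitive α (y (midIndex n)) / r

/-- The label of the tube that contains `y`. -/
noncomputable def tubeLabel (α : ℝ → ℝ) (r : ℝ) (y : RSpace n) (i : Fin n) : ℤ :=
  ⌊tubeParam α r y i⌋

theorem measurable_tubeLabel {α : ℝ → ℝ} (hc : Continuous α) (r : ℝ) :
    Measurable (tubeLabel (n := n) α r) := by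
  have hcoord : ∀ i : Fin n, Measurable fun y : RSpace n => y i := fun i =>
    Continuous.measurable (by fun_prop)
  have hA : Measurable fun y : RSpace n => primitive α (y (midIndex n)) :=
    (continuous_primitive hc).measurable.comp (hcoord _)
  have hparam : ∀ i : Fin n, Measurable fun y : RSpace n => tubeParam α r y i := by
    intro i
    unfold tubeParam
    split_ifs
    · exact ((hcoord i).sub ((hcoord (midIndex n)).mul ((hcoord i.rev).div hA))).div_const r
    · exact measurable_const
    · exact ((hcoord i).div hA).div_const r
  exact measurable_pi_iff.2 fun i => (hparam i).floor

/-- The slope of the tube with label `j`. Only the entries below the middle index matter. -/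
def tubeSlope (r : ℝ) (j : Fin n → ℤ) (i : Fin n) : ℝ :=
  if i < midIndex n then r * j i.rev else 0

/-- The part of the tube with label `j` at heights in `[0, h]`. -/
def tubeTop (r h : ℝ) (j : Fin n → ℤ) : Set (RSpace n) :=
  shearedBox (tubeSlope r j)
    (fun i => if i < midIndex n then r * j i - r else if i = midIndex n then 0 else -r)
    (fun i => if i < midIndex n then r * j i + r else if i = midIndex n then h else r)

/-- The `r`-neighbourhood of the hyperplane on which all the tubes concentrate. -/
def slab (n : ℕ) [NeZero n] (r h : ℝ) : Set (RSpace n) :=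
  shearedBox 0 (fun i => if i < midIndex n then -1 else if i = midIndex n then 0 else -r)
    (fun i => if i < midIndex n then 1 else if i = midIndex n then h else r)

theorem midIndex_lt_rev (hodd : Odd n) {i : Fin n} (hi : i ∈ Finset.Iio (midIndex n)) :
    midIndex n < i.rev := by
  have hrev := rev_midIndex n hodd
  rw [Finset.mem_Iio] at hi
  rw [← hrev]
  exact Fin.rev_lt_rev.2 hi

theorem volume_tubeTop (hodd : Odd n) {r h : ℝ} (hr : 0 ≤ r) (hh : 0 ≤ h) (j : Fin n → ℤ) :
    volume (tubeTop r h j) = ENNReal.ofReal (h * (2 * r * (2 * r)) ^ ((n - 1) / 2)) := by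
  rw [tubeTop, volume_shearedBox _ _ _ (by simp [tubeSlope]),
    prod_eq_mid_mul_prod_pairs hodd, ← card_Iio_midIndex]
  rw [Finset.prod_congr rfl (g := fun _ => ENNReal.ofReal (2 * r * (2 * r)))]
  · rw [Finset.prod_const, ← ENNReal.ofReal_pow (by positivity), ENNReal.ofReal_mul hh]
    simp
  · intro i hi
    have hi' := midIndex_lt_rev hodd hi
    rw [Finset.mem_Iio] at hi
    simp only [hi, hi'.not_gt, hi'.ne', if_true, if_false]
    rw [← ENNReal.ofReal_mul (by linarith)]
    congr 1
    ring

theorem volume_slab (hodd : Odd n) {r h : ℝ} (hr : 0 ≤ r) (hh : 0 ≤ h) :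
    volume (slab n r h) = ENNReal.ofReal (h * (4 * r) ^ ((n - 1) / 2)) := by
  rw [slab, volume_shearedBox _ _ _ (by simp), prod_eq_mid_mul_prod_pairs hodd,
    ← card_Iio_midIndex]
  rw [Finset.prod_congr rfl (g := fun _ => ENNReal.ofReal (4 * r))]
  · rw [Finset.prod_const, ← ENNReal.ofReal_pow (by positivity), ENNReal.ofReal_mul hh]
    simp
  · intro i hi
    have hi' := midIndex_lt_rev hodd hi
    rw [Finset.mem_Iio] at hi
    simp only [hi, hi'.not_gt, hi'.ne', if_true, if_false]
    rw [← ENNReal.ofReal_mul (by norm_num)]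
    congr 1
    ring

end

/-! ### Functions with concentrated image -/

section

variable {n : ℕ} [NeZero n]

theorem abs_sub_mul_floor_div_le {r : ℝ} (hr : 0 < r) (z : ℝ) : |z - r * ⌊z / r⌋| ≤ r := by
  have h1 := Int.floor_le (z / r)
  have h2 := Int.lt_floor_add_one (z / r)
  rw [le_div_iff₀ hr] at h1
  rw [div_lt_iff₀ hr] at h2
  rw [abs_le]
  constructor <;> linarith

theorem norm_le_card_mul_of_abs_apply_le {η : ℝ} (hη : 0 ≤ η) {x : RSpace n}
    (hx : ∀ i, |x i| ≤ η) : ‖x‖ ≤ n * η := by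
  have hn : (1 : ℝ) ≤ n := by exact_mod_cast NeZero.pos n
  refine le_of_sq_le_sq ?_ (by positivity)
  rw [EuclideanSpace.norm_sq_eq]
  calc ∑ i, ‖x i‖ ^ 2 ≤ ∑ _i : Fin n, η ^ 2 :=
        Finset.sum_le_sum fun i _ => pow_le_pow_left₀ (norm_nonneg _) (hx i) 2
    _ = n * η ^ 2 := by simp
    _ ≤ (n * η) ^ 2 := by nlinarith [mul_nonneg (sq_nonneg η) (show (0 : ℝ) ≤ n by positivity)]

/-- A point `y` near height `-1` and the top of its tube lie within `4 r` of a common geodesic. -/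
theorem tubeTop_tubeLabel_estimates (hodd : Odd n) {α : ℝ → ℝ} (hα : ∀ s, |α s| < 1)
    (hc : Continuous α) {r h η A₀ : ℝ} (hr : 0 < r) (hrη : r ≤ η / 8) (hhη : h ≤ η)
    (hη : η ≤ 1 / 4) (hA₀ : 0 < A₀) (hprim : ∀ t ∈ Set.Icc 0 h, |primitive α t| ≤ r)
    {y : RSpace n} (hy1 : |y (midIndex n) + 1| ≤ 1 / 4)
    (hyA : A₀ ≤ |primitive α (y (midIndex n))|)
    (hy2 : ∀ i ≠ midIndex n, |y i| ≤ η / 8) (hy3 : ∀ i ≠ midIndex n, |y i| ≤ A₀ * (η / 8))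
    {x : RSpace n} (hx : x ∈ tubeTop r h (tubeLabel α r y)) :
    (∀ i, |tubeParam α r y i| ≤ 1 / r) ∧ (∀ i, |x i| ≤ η) ∧ x ∈ slab n r h ∧
    (∀ i ∈ Finset.Iio (midIndex n), |x i - y i -
      (x (midIndex n) - y (midIndex n)) * tubeSlope r (tubeLabel α r y) i| ≤ 4 * r) ∧
    ∀ i ∈ Finset.Iio (midIndex n), |x i.rev - y i.rev - tubeSlope r (tubeLabel α r y) i *
      (∫ s in (y (midIndex n))..(x (midIndex n)), α s)| ≤ 4 * r := by
  have hrev := rev_midIndex n hodd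
  rw [integral_eq_primitive_sub hc]
  have hxc : 0 ≤ x (midIndex n) ∧ x (midIndex n) ≤ h := by
    have := hx (midIndex n)
    simpa [tubeSlope] using this
  have hAabs : |primitive α (y (midIndex n))| ≤ 5 / 4 := by
    refine (abs_primitive_le hα _).trans ?_
    rw [abs_le] at hy1 ⊢
    constructor <;> linarith
  have hB := hprim _ hxc
  set s := y (midIndex n) with hs
  set t := x (midIndex n) with ht
  set A := primitive α s with hA
  set B := primitive α t with hBdef
  set j := tubeLabel α r y with hj
  have hA0 : A ≠ 0 := fun h0 => by rw [h0, abs_zero] at hyA; linarith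
  have hs54 : |s| ≤ 5 / 4 := by
    rw [abs_le] at hy1 ⊢
    constructor <;> linarith
  -- the slope `W` and the position `P` at height `0` of the geodesic through `y`
  let W : Fin n → ℝ := fun i => y i.rev / A
  let P : Fin n → ℝ := fun i => y i - s * W i
  have hyW : ∀ i, y i.rev = A * W i := fun i => by simp only [W]; field_simp
  have hhalf : ∀ i ∈ Finset.Iio (midIndex n), |W i| ≤ η / 8 ∧ |P i| ≤ 9 / 32 * η ∧
      tubeParam α r y i = P i / r ∧ tubeParam α r y i.rev = W i / r ∧
      tubeSlope r j i = r * j i.rev ∧ |P i - r * j i| ≤ r ∧ |W i - tubeSlope r j i| ≤ r ∧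
      |x i - r * j i - t * tubeSlope r j i| ≤ r ∧ |x i.rev| ≤ r := by
    intro i hi
    have hi' := midIndex_lt_rev hodd hi
    rw [Finset.mem_Iio] at hi
    have hW : |W i| ≤ η / 8 := by
      simp only [W]
      rw [abs_div, div_le_iff₀ (lt_of_lt_of_le hA₀ hyA)]
      calc |y i.rev| ≤ A₀ * (η / 8) := hy3 _ hi'.ne'
        _ ≤ |A| * (η / 8) := mul_le_mul_of_nonneg_right hyA (by linarith)
        _ = η / 8 * |A| := mul_comm _ _
    have hP : |P i| ≤ 9 / 32 * η := by
      have h1 : |s * W i| ≤ 5 / 4 * (η / 8) := by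
        rw [abs_mul]
        exact mul_le_mul hs54 hW (abs_nonneg _) (by norm_num)
      have h2 : |P i| ≤ |y i| + |s * W i| := abs_sub _ _
      linarith [hy2 i hi.ne]
    have e1 : tubeParam α r y i = P i / r := by
      simp only [tubeParam, hi, if_true, P, W]
      rfl
    have e2 : tubeParam α r y i.rev = W i / r := by
      simp only [tubeParam, hi'.not_gt, hi'.ne', if_false, W]
      rfl
    have e3 : tubeSlope r j i = r * j i.rev := by simp [tubeSlope, hi]
    refine ⟨hW, hP, e1, e2, e3, ?_, ?_, ?_, ?_⟩
    · rw [hj, tubeLabel, e1]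
      exact abs_sub_mul_floor_div_le hr _
    · rw [e3, hj, tubeLabel, e2]
      exact abs_sub_mul_floor_div_le hr _
    · have h1 := hx i
      simp only [hi, if_true, Set.mem_Icc] at h1
      rw [abs_le]
      constructor <;> linarith [h1.1, h1.2]
    · have h1 := hx i.rev
      simp only [hi'.not_gt, hi'.ne', if_false, Set.mem_Icc, tubeSlope, mul_zero, sub_zero] at h1
      exact abs_le.2 h1
  have hη0 : 0 < η := by linarith
  have hslope : ∀ i ∈ Finset.Iio (midIndex n), |tubeSlope r j i| ≤ η / 4 := by
    intro i hi
    obtain ⟨hW, -, -, -, -, -, h7, -, -⟩ := hhalf i hi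
    rw [abs_le] at hW h7 ⊢
    constructor <;> linarith
  have hxi : ∀ i ∈ Finset.Iio (midIndex n), |x i| ≤ η := by
    intro i hi
    obtain ⟨-, hP, -, -, -, h6, -, h8, -⟩ := hhalf i hi
    have h1 : |t * tubeSlope r j i| ≤ 1 / 4 * (η / 4) := by
      rw [abs_mul, abs_of_nonneg hxc.1]
      exact mul_le_mul (by linarith) (hslope i hi) (abs_nonneg _) (by norm_num)
    rw [abs_le] at hP h6 h8 h1 ⊢
    constructor <;> linarith
  -- every index is the middle one, below it, or the reverse of one below it
  have hcases : ∀ i : Fin n, i = midIndex n ∨ i ∈ Finset.Iio (midIndex n) ∨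
      ∃ k ∈ Finset.Iio (midIndex n), i = k.rev := by
    intro i
    rcases lt_trichotomy i (midIndex n) with h1 | h1 | h1
    · exact Or.inr (Or.inl (Finset.mem_Iio.2 h1))
    · exact Or.inl h1
    · refine Or.inr (Or.inr ⟨i.rev, ?_, (Fin.rev_rev i).symm⟩)
      rw [Finset.mem_Iio, ← hrev]
      exact Fin.rev_lt_rev.2 h1
  refine ⟨fun i => ?_, fun i => ?_, fun i => ?_, fun i hi => ?_, fun i hi => ?_⟩
  · rcases hcases i with rfl | hi | ⟨k, hk, rfl⟩
    · simpa [tubeParam] using hr.le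
    · obtain ⟨-, hP, e1, -⟩ := hhalf i hi
      rw [e1, abs_div, abs_of_pos hr]
      exact div_le_div_of_nonneg_right (by linarith) hr.le
    · obtain ⟨hW, -, -, e2, -⟩ := hhalf k hk
      rw [e2, abs_div, abs_of_pos hr]
      exact div_le_div_of_nonneg_right (by linarith) hr.le
  · rcases hcases i with rfl | hi | ⟨k, hk, rfl⟩
    · rw [← ht, abs_of_nonneg hxc.1]
      linarith
    · exact hxi i hi
    · obtain ⟨-, -, -, -, -, -, -, -, h9⟩ := hhalf k hk
      linarith
  · simp only [Pi.zero_apply, mul_zero, sub_zero]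
    rcases hcases i with rfl | hi | ⟨k, hk, rfl⟩
    · simpa using hxc
    · have h1 := abs_le.1 (hxi i hi)
      rw [Finset.mem_Iio] at hi
      simp only [hi, if_true]
      constructor <;> linarith [h1.1, h1.2]
    · obtain ⟨-, -, -, -, -, -, -, -, h9⟩ := hhalf k hk
      have hk' := midIndex_lt_rev hodd hk
      simp only [hk'.not_gt, hk'.ne', if_false]
      exact abs_le.1 h9
  · obtain ⟨-, -, -, -, -, h6, h7, h8, -⟩ := hhalf i hi
    have h1 : |s * (W i - tubeSlope r j i)| ≤ 5 / 4 * r := by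
      rw [abs_mul]
      exact mul_le_mul hs54 h7 (abs_nonneg _) (by norm_num)
    have h2 : x i - y i - (t - s) * tubeSlope r j i =
        (x i - r * j i - t * tubeSlope r j i) - (P i - r * j i) -
          s * (W i - tubeSlope r j i) := by
      simp only [P]
      ring
    rw [h2]
    rw [abs_le] at h6 h8 h1 ⊢
    constructor <;> linarith
  · obtain ⟨-, -, -, -, -, -, h7, -, h9⟩ := hhalf i hi
    have h1 : |A * (W i - tubeSlope r j i)| ≤ 5 / 4 * r := by
      rw [abs_mul]
      exact mul_le_mul hAabs h7 (abs_nonneg _) (by norm_num)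
    have h2 : |tubeSlope r j i * B| ≤ 1 * r := by
      rw [abs_mul]
      exact mul_le_mul (by linarith [hslope i hi]) hB (abs_nonneg _) (by norm_num)
    have h3 : x i.rev - y i.rev - tubeSlope r j i * (B - A) =
        x i.rev - A * (W i - tubeSlope r j i) - tubeSlope r j i * B := by
      rw [hyW i]
      ring
    rw [h3]
    rw [abs_le] at h9 h1 h2 ⊢
    constructor <;> linarith

/-- The labels of tubes, with entries bounded by about `1 / r`. -/
noncomputable def labelRange (n : ℕ) [NeZero n] (r : ℝ) : Finset (Fin n → ℤ) :=
  Fintype.piFinset fun i => if i = midIndex n then {0} else Finset.Icc (-⌈1 / r⌉) ⌈1 / r⌉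

theorem tubeLabel_mem_labelRange {α : ℝ → ℝ} {r : ℝ} {y : RSpace n}
    (h : ∀ i, |tubeParam α r y i| ≤ 1 / r) : tubeLabel α r y ∈ labelRange n r := by
  rw [labelRange, Fintype.mem_piFinset]
  intro i
  split_ifs with hi
  · subst hi
    simp [tubeLabel, tubeParam]
  · have h1 := abs_le.1 (h i)
    rw [Finset.mem_Icc, tubeLabel]
    constructor
    · rw [Int.le_floor]
      push_cast
      linarith [Int.le_ceil (1 / r)]
    · have : (⌊tubeParam α r y i⌋ : ℝ) ≤ ⌈1 / r⌉ :=
        (Int.floor_le _).trans (h1.2.trans (Int.le_ceil _))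
      exact_mod_cast this

theorem card_labelRange_le (hodd : Odd n) {r : ℝ} (hr : 0 < r) (hr1 : r ≤ 1) :
    ((labelRange n r).card : ℝ) ≤ (25 / r ^ 2) ^ ((n - 1) / 2) := by
  rw [labelRange, Fintype.card_piFinset, prod_eq_mid_mul_prod_pairs hodd, ← card_Iio_midIndex,
    if_pos rfl, Finset.card_singleton, one_mul, Nat.cast_prod, ← Finset.prod_const]
  refine Finset.prod_le_prod (fun i _ => Nat.cast_nonneg _) fun i hi => ?_
  have hi' := midIndex_lt_rev hodd hi
  rw [Finset.mem_Iio] at hi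
  rw [if_neg hi.ne, if_neg hi'.ne', Int.card_Icc, Nat.cast_mul]
  have h1 : 1 ≤ 1 / r := by rwa [le_div_iff₀ hr, one_mul]
  have h2 : (⌈1 / r⌉ : ℝ) < 1 / r + 1 := Int.ceil_lt_add_one _
  have h3 : 0 ≤ ⌈1 / r⌉ := Int.ceil_nonneg (by linarith)
  have h4 : (((⌈1 / r⌉ + 1 - -⌈1 / r⌉).toNat : ℕ) : ℝ) ≤ 5 / r := by
    have : (((⌈1 / r⌉ + 1 - -⌈1 / r⌉).toNat : ℤ) : ℝ) = 2 * ⌈1 / r⌉ + 1 := by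
      rw [Int.toNat_of_nonneg (by linarith)]
      push_cast
      ring
    rw [Int.cast_natCast] at this
    rw [this, show 5 / r = 5 * (1 / r) by ring]
    linarith
  calc _ ≤ 5 / r * (5 / r) := mul_le_mul h4 h4 (Nat.cast_nonneg _) (by positivity)
    _ = 25 / r ^ 2 := by field_simp; norm_num

theorem IsAmplitude.exists_lower_bound {a : RSpace n → RSpace n → ℝ} (ha : IsAmplitude n a) :
    ∃ κ η : ℝ, 0 < κ ∧ 0 < η ∧ η ≤ 1 / 4 ∧ ∀ x y : RSpace n, (∀ i, |x i| ≤ η) →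
      ‖y - basePoint n‖ ≤ η → κ ≤ a x y := by
  have hpos : 0 < a 0 (basePoint n) := lt_of_le_of_ne (ha.nonneg _ _) (Ne.symm ha.ne_zero)
  have hcont : ContinuousAt (fun z : RSpace n × RSpace n => a z.1 z.2) (0, basePoint n) :=
    ha.smooth.continuous.continuousAt
  obtain ⟨δ, hδ, hball⟩ := Metric.eventually_nhds_iff.1
    (hcont.eventually (lt_mem_nhds (show a 0 (basePoint n) / 2 < a 0 (basePoint n) by linarith)))
  have hn : (1 : ℝ) ≤ n := by exact_mod_cast NeZero.pos n
  have hη0 : 0 < min (1 / 4) (δ / (2 * n)) := by positivity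
  have hη : min (1 / 4) (δ / (2 * n)) ≤ δ / (2 * n) := min_le_right _ _
  refine ⟨a 0 (basePoint n) / 2, min (1 / 4) (δ / (2 * n)), by linarith, hη0,
    min_le_left _ _, fun x y hx hy => ?_⟩
  have hnη : n * min (1 / 4) (δ / (2 * n)) ≤ δ / 2 := by
    calc _ ≤ n * (δ / (2 * n)) := mul_le_mul_of_nonneg_left hη (by linarith)
      _ = δ / 2 := by field_simp
  refine (hball (y := (x, y)) ?_).le
  rw [Prod.dist_eq, max_lt_iff]
  constructor
  · rw [dist_zero_right]
    exact (norm_le_card_mul_of_abs_apply_le hη0.le hx).trans_lt (by linarith)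
  · rw [dist_eq_norm]
    nlinarith

theorem abs_apply_le_norm_sub_basePoint (y : RSpace n) {i : Fin n} (hi : i ≠ midIndex n) :
    |y i| ≤ ‖y - basePoint n‖ := by
  have := abs_apply_le_norm (y - basePoint n) i
  simpa [basePoint, hi] using this

theorem abs_apply_midIndex_add_one_le (y : RSpace n) :
    |y (midIndex n) + 1| ≤ ‖y - basePoint n‖ := by
  have := abs_apply_le_norm (y - basePoint n) (midIndex n)
  simpa [basePoint] using this

theorem apply_midIndex_nonneg_of_mem_slab {r h : ℝ} {x : RSpace n} (hx : x ∈ slab n r h) :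
    0 ≤ x (midIndex n) := by
  have := (hx (midIndex n)).1
  simpa using this

theorem exists_frequency_constant (m K : ℝ) (hm : 0 ≤ m) (hK : 0 ≤ K) :
    ∃ c₁ : ℝ, 0 < c₁ ∧ ∀ r : ℝ, 0 < r →
      c₁ / r ^ 2 * (m * ((1 + 4 * K) * (4 * r) ^ 2)) ≤ 1 := by
  refine ⟨1 / (m * ((1 + 4 * K) * 16) + 1), by positivity, fun r hr => ?_⟩
  have h2 : 1 / (m * ((1 + 4 * K) * 16) + 1) / r ^ 2 * (m * ((1 + 4 * K) * (4 * r) ^ 2)) =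
      m * ((1 + 4 * K) * 16) / (m * ((1 + 4 * K) * 16) + 1) := by
    have : m * ((1 + 4 * K) * 16) + 1 ≠ 0 := by positivity
    field_simp
    ring
  rw [h2]
  exact div_le_one_of_le₀ (by linarith) (by positivity)

theorem tube_count_identity (κ v h : ℝ) {r : ℝ} (hr : 0 < r) (m : ℕ) :
    (κ / 2) ^ 2 * v ^ 2 * (4 / 25) ^ m * (h * (r ^ 4) ^ m) =
      (κ / 2) ^ 2 * (h * (2 * r * (2 * r)) ^ m) * (v ^ 2 / (25 / r ^ 2) ^ m) := by
  have h1 : (4 / 25 : ℝ) ^ m * (r ^ 4) ^ m = (2 * r * (2 * r)) ^ m / (25 / r ^ 2) ^ m := by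
    rw [← div_pow, ← mul_pow]
    congr 1
    field_simp
    ring
  calc _ = (κ / 2) ^ 2 * v ^ 2 * h * ((4 / 25) ^ m * (r ^ 4) ^ m) := by ring
    _ = _ := by rw [h1]; ring

/-- At frequency `c₁ / r ^ 2` there is a bounded function on a fixed ball around the base point
whose image has, in `L²` of the slab of width `r`, the size of the largest possible `L²` norm over
the whole space, apart from the factor `h`. -/
theorem exists_bounded_le_lintegral_slab (hodd : Odd n) {α : ℝ → ℝ} (hα : ∀ s, |α s| < 1)
    (hc : Continuous α) (hneg : ∀ s < 0, 0 < α s) {a : RSpace n → RSpace n → ℝ}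
    (ha : IsAmplitude n a) :
    ∃ (R : Set (RSpace n)) (c₀ c₁ η : ℝ), volume R ≠ ⊤ ∧ 0 < c₀ ∧ 0 < c₁ ∧ 0 < η ∧
      ∀ r h, 0 < r → r ≤ η → 0 < h → h ≤ η → (∀ t ∈ Set.Icc 0 h, |primitive α t| ≤ r) →
        ∃ f : RSpace n → ℂ, Measurable f ∧ (∀ y, ‖f y‖ ≤ 1) ∧ (∀ y ∉ R, f y = 0) ∧
          ENNReal.ofReal (c₀ * (h * (r ^ 4) ^ ((n - 1) / 2))) ≤
            ∫⁻ x in slab n r h,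
              ‖oscOp (metricDist (dualMetric n α)) a (c₁ / r ^ 2) f x‖ₑ ^ 2 := by
  obtain ⟨κ, η, hκ, hη, hη4, hκa⟩ := ha.exists_lower_bound
  obtain ⟨M, hM⟩ := ha.compactSupport.exists_bound_of_continuous ha.smooth.continuous
  -- the ellipticity constant over the heights in question
  have hsq : ∀ s, 0 < 1 - α s ^ 2 := fun s => by
    have := (sq_lt_one_iff_abs_lt_one _).2 (hα s)
    linarith
  obtain ⟨K₀, hK₀⟩ := (isCompact_Icc (a := -(5 / 4 : ℝ)) (b := 1 / 4)).exists_bound_of_continuousOn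
    (f := fun s => (1 - α s ^ 2)⁻¹)
    ((continuous_const.sub (hc.pow 2)).inv₀ fun s => (hsq s).ne').continuousOn
  set K := |K₀| with hKdef
  have hK : ∀ s ∈ Set.Icc (-(5 / 4 : ℝ)) (1 / 4), (1 - α s ^ 2)⁻¹ ≤ K := fun s hs =>
    (le_abs_self _).trans ((hK₀ s hs).trans (le_abs_self _))
  have hK0 : 0 ≤ K := abs_nonneg _
  -- the slopes are of unit size compared with the position at height near `-1`
  obtain ⟨s₀, hs₀, hmin⟩ := (isCompact_Icc (a := -(5 / 4 : ℝ)) (b := -(3 / 4))).exists_isMinOn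
    (Set.nonempty_Icc.2 (by norm_num)) (continuous_primitive hc).abs.continuousOn
  set A₀ := |primitive α s₀| with hA₀def
  have hA₀ : 0 < A₀ := abs_pos.2
    (primitive_neg_of_neg hc hneg (lt_of_le_of_lt hs₀.2 (by norm_num))).ne
  set ρ := min (η / 8) (A₀ * (η / 8)) with hρ
  have hρ0 : 0 < ρ := by positivity
  set R := Metric.closedBall (basePoint n) ρ with hR
  have hRfin : volume R ≠ ⊤ := measure_closedBall_lt_top.ne
  have hRpos : 0 < (volume R).toReal :=
    ENNReal.toReal_pos (Metric.measure_closedBall_pos _ _ hρ0).ne' hRfin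
  set m : ℝ := ((Finset.Iio (midIndex n)).card : ℝ) with hm
  have hm0 : 0 ≤ m := Nat.cast_nonneg _
  obtain ⟨c₁, hc₁, hfreq⟩ := exists_frequency_constant m K hm0 hK0
  refine ⟨R, (κ / 2) ^ 2 * (volume R).toReal ^ 2 * (4 / 25) ^ ((n - 1) / 2),
    c₁, min (η / 8) (1 / (16 * (m + 1))), hRfin, by positivity, hc₁,
    by positivity, fun r h hr hrη hh hhη hprim => ?_⟩
  have hrη' : r ≤ η / 8 := hrη.trans (min_le_left _ _)
  have hhη' : h ≤ η := (hhη.trans (min_le_left _ _)).trans (by linarith)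
  have hrm : m * (4 * r) ^ 2 ≤ 1 / 16 := by
    have h1 : r * (16 * (m + 1)) ≤ 1 := by
      rw [← le_div_iff₀ (by positivity)]
      exact hrη.trans (min_le_right _ _)
    have h2 : 16 * (m + 1) * r * (16 * (m + 1) * r) ≤ 1 * 1 :=
      mul_le_mul (by linarith) (by linarith) (by positivity) (by norm_num)
    have h3 : m * r ^ 2 ≤ (m + 1) ^ 2 * r ^ 2 :=
      mul_le_mul_of_nonneg_right (by nlinarith) (sq_nonneg r)
    have h4 : 16 * (m + 1) * r * (16 * (m + 1) * r) = 256 * ((m + 1) ^ 2 * r ^ 2) := by ring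
    rw [mul_pow]
    linarith
  have hest : ∀ y ∈ R, ∀ x ∈ tubeTop r h (tubeLabel α r y), _ := fun y hy x hx => by
    have hyρ : ‖y - basePoint n‖ ≤ ρ := by rwa [hR, Metric.mem_closedBall, dist_eq_norm] at hy
    have hy1 : |y (midIndex n) + 1| ≤ 1 / 4 := (abs_apply_midIndex_add_one_le y).trans
      (hyρ.trans ((min_le_left _ _).trans (by linarith)))
    refine tubeTop_tubeLabel_estimates hodd hα hc hr hrη' hhη' hη4 hA₀ hprim hy1 ?_
      (fun i hi => (abs_apply_le_norm_sub_basePoint y hi).trans (hyρ.trans (min_le_left _ _)))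
      (fun i hi => (abs_apply_le_norm_sub_basePoint y hi).trans (hyρ.trans (min_le_right _ _))) hx
    rw [abs_le] at hy1
    exact hmin (show y (midIndex n) ∈ Set.Icc (-(5 / 4 : ℝ)) (-(3 / 4)) from
      ⟨by linarith, by linarith⟩)
  have hne : ∀ y, (tubeTop r h (tubeLabel (n := n) α r y)).Nonempty := fun y => by
    refine nonempty_of_measure_ne_zero (μ := volume) ?_
    rw [volume_tubeTop hodd hr.le hh.le]
    exact (ENNReal.ofReal_pos.2 (by positivity)).ne'
  have hdiff : ∀ y ∈ R, ∀ x ∈ tubeTop r h (tubeLabel α r y),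
      metricDist (dualMetric n α) x y - slopeFunctional n (tubeSlope r (tubeLabel α r y)) (x - y) ≤
        m * ((1 + 4 * K) * (4 * r) ^ 2) := by
    intro y hy x hx
    obtain ⟨-, h2, h3, h4, h5⟩ := hest y hy x hx
    have hyρ : ‖y - basePoint n‖ ≤ ρ := by rwa [hR, Metric.mem_closedBall, dist_eq_norm] at hy
    have hy1 := abs_le.1 ((abs_apply_midIndex_add_one_le y).trans (hyρ.trans (min_le_left _ _)))
    have hx0 : 0 ≤ x (midIndex n) := apply_midIndex_nonneg_of_mem_slab h3
    have hx1 := (abs_le.1 (h2 (midIndex n))).2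
    exact metricDist_sub_slopeFunctional_le hodd hα hc _ x y hx0 (by linarith)
      (fun s hs => hK s ⟨by linarith [hs.1], by linarith [hs.2]⟩) hrm h4 h5
  obtain ⟨f, hf, hf1, hfR, hle⟩ := exists_bounded_le_lintegral_oscOp_sq
    (continuous_metricDist hodd hα hc) ha.smooth.continuous
    (fun x y => hM (x, y)) (lam := c₁ / r ^ 2) (κ := κ)
    (V := h * (2 * r * (2 * r)) ^ ((n - 1) / 2)) (div_pos hc₁ (pow_pos hr 2)).le hκ.le (by positivity)
    (R := R) (E := slab n r h) hRfin (tubeLabel α r)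
    (fun j => measurableSet_closedBall.inter
      (measurable_tubeLabel hc r (measurableSet_singleton j)))
    (labelRange n r)
    (fun y hy => tubeLabel_mem_labelRange (hest y hy _ (hne y).some_mem).1)
    (fun j => slopeFunctional n (tubeSlope r j)) (tubeTop r h)
    (fun j => measurableSet_shearedBox _ _ _)
    (fun y hy x hx => (hest y hy x hx).2.2.1)
    (fun y hy => (volume_tubeTop hodd hr.le hh.le _).ge)
    (fun y hy x hx => slopeFunctional_le_metricDist hodd hα hc _ x y)
    (fun y hy x hx => (mul_le_mul_of_nonneg_left (hdiff y hy x hx)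
      (div_pos hc₁ (pow_pos hr 2)).le).trans (hfreq r hr))
    (fun y hy x hx => hκa x y (hest y hy x hx).2.1 (by
      have hyρ : ‖y - basePoint n‖ ≤ ρ := by rwa [hR, Metric.mem_closedBall, dist_eq_norm] at hy
      exact hyρ.trans ((min_le_left _ _).trans (by linarith))))
  refine ⟨f, hf, hf1, hfR, le_trans (ENNReal.ofReal_le_ofReal ?_) hle⟩
  have hcard := card_labelRange_le (n := n) hodd hr (by linarith)
  have hcard0 : 0 < ((labelRange n r).card : ℝ) := by
    rw [Nat.cast_pos, Finset.card_pos]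
    exact ⟨_, tubeLabel_mem_labelRange
      (hest _ (Metric.mem_closedBall_self hρ0.le) _ (hne _).some_mem).1⟩
  rw [tube_count_identity κ _ h hr]
  exact mul_le_mul_of_nonneg_left (div_le_div_of_nonneg_left (sq_nonneg _) hcard0 hcard)
    (by positivity)

end

/-! ### Comparison with the conjectured bounds -/

section

theorem lintegral_sq_le_of_two_le {X : Type*} [MeasurableSpace X] {μ : Measure X} {g : X → ℂ}
    (hg : Measurable g) (E : Set X) {q : ℝ≥0∞} (hq : 2 ≤ q) :
    ∫⁻ x in E, ‖g x‖ₑ ^ 2 ∂μ ≤ eLpNorm g q μ ^ 2 * μ E ^ (1 - 2 / q.toReal) := by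
  have h1 := eLpNorm_le_eLpNorm_mul_rpow_measure_univ hq
    (hg.aestronglyMeasurable (μ := μ.restrict E))
  rw [Measure.restrict_apply_univ] at h1
  have h2 : ∫⁻ x in E, ‖g x‖ₑ ^ 2 ∂μ = eLpNorm g 2 (μ.restrict E) ^ 2 := by
    rw [eLpNorm_eq_lintegral_rpow_enorm_toReal two_ne_zero ENNReal.ofNat_ne_top,
      ← ENNReal.rpow_natCast, ← ENNReal.rpow_mul]
    simp
  rw [h2]
  calc eLpNorm g 2 (μ.restrict E) ^ 2
      ≤ (eLpNorm g q (μ.restrict E) * μ E ^ (1 / (2 : ℝ≥0∞).toReal - 1 / q.toReal)) ^ 2 :=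
        pow_le_pow_left' h1 2
    _ = eLpNorm g q (μ.restrict E) ^ 2 * μ E ^ (1 - 2 / q.toReal) := by
        rw [mul_pow, ← ENNReal.rpow_natCast (μ E ^ _), ← ENNReal.rpow_mul]
        congr 2
        rw [ENNReal.toReal_ofNat]
        push_cast
        ring
    _ ≤ _ := by
        gcongr
        exact Measure.restrict_le_self

theorem lintegral_sq_le_of_le_two {X : Type*} [MeasurableSpace X] {μ : Measure X} {g : X → ℂ}
    {B : ℝ} (hB : ∀ x, ‖g x‖ ≤ B) (E : Set X) {q : ℝ≥0∞} (hq0 : q ≠ 0) (hq : q ≤ 2) :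
    ∫⁻ x in E, ‖g x‖ₑ ^ 2 ∂μ ≤
      ENNReal.ofReal B ^ (2 - q.toReal) * eLpNorm g q μ ^ q.toReal := by
  have hqtop : q ≠ ⊤ := ne_top_of_le_ne_top ENNReal.ofNat_ne_top hq
  have hqpos : 0 < q.toReal := ENNReal.toReal_pos hq0 hqtop
  have hq2 : q.toReal ≤ 2 := by simpa using ENNReal.toReal_mono ENNReal.ofNat_ne_top hq
  have hpow : eLpNorm g q μ ^ q.toReal = ∫⁻ x, ‖g x‖ₑ ^ q.toReal ∂μ := by
    rw [eLpNorm_eq_lintegral_rpow_enorm_toReal hq0 hqtop, ← ENNReal.rpow_mul,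
      one_div_mul_cancel hqpos.ne', ENNReal.rpow_one]
  have hfin : ENNReal.ofReal B ^ (2 - q.toReal) ≠ ⊤ :=
    ENNReal.rpow_ne_top_of_nonneg (by linarith) ENNReal.ofReal_ne_top
  rw [hpow, ← lintegral_const_mul' _ _ hfin]
  refine (setLIntegral_le_lintegral _ _).trans (lintegral_mono fun x => ?_)
  have h1 : ‖g x‖ₑ ^ 2 = ‖g x‖ₑ ^ (2 - q.toReal) * ‖g x‖ₑ ^ q.toReal := by
    rw [← ENNReal.rpow_add_of_nonneg _ _ (by linarith) hqpos.le, sub_add_cancel]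
    exact (ENNReal.rpow_natCast _ 2).symm
  rw [h1]
  gcongr
  rw [← ofReal_norm]
  exact ENNReal.ofReal_le_ofReal (hB x)

theorem OscBound.exists_bound_of_bounded {n : ℕ} {d a : RSpace n → RSpace n → ℝ} {p q : ℝ≥0∞}
    (hb : OscBound d a p q) {R : Set (RSpace n)} (hRfin : volume R ≠ ⊤)
    {ε : ℝ} (hε : 0 < ε) :
    ∃ C : ℝ, 0 ≤ C ∧ ∀ lam : ℝ, 1 ≤ lam → ∀ f : RSpace n → ℂ, Measurable f →
      (∀ y, ‖f y‖ ≤ 1) → (∀ y ∉ R, f y = 0) →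
      eLpNorm (oscOp d a lam f) q volume ≤
        ENNReal.ofReal (C * lam ^ (-((n : ℝ) / q.toReal) + ε)) := by
  obtain ⟨C, hC⟩ := hb ε hε
  set D := ‖(1 : ℝ)‖ₑ * volume R ^ (1 / p.toReal) with hD
  have hDfin : D ≠ ⊤ := ENNReal.mul_ne_top enorm_ne_top
    (ENNReal.rpow_ne_top_of_nonneg (by positivity) hRfin)
  refine ⟨|C| * D.toReal, by positivity, fun lam hlam f hf hf1 hfR => ?_⟩
  have hfD : eLpNorm f p volume ≤ D := by
    refine (eLpNorm_mono_real (g := R.indicator fun _ => (1 : ℝ)) fun y => ?_).trans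
      (eLpNorm_indicator_const_le _ _)
    by_cases hy : y ∈ R
    · simpa [hy] using hf1 y
    · simp [hy, hfR y hy]
  have hmem : MemLp f p volume := ⟨hf.aestronglyMeasurable, hfD.trans_lt hDfin.lt_top⟩
  have hpow : 0 ≤ lam ^ (-((n : ℝ) / q.toReal) + ε) := Real.rpow_nonneg (by linarith) _
  refine (hC lam hlam f hmem).trans ?_
  calc _ ≤ ENNReal.ofReal (|C| * lam ^ (-((n : ℝ) / q.toReal) + ε)) * D := by
        gcongr
        exact le_abs_self C
    _ = ENNReal.ofReal (|C| * lam ^ (-((n : ℝ) / q.toReal) + ε)) * ENNReal.ofReal D.toReal := by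
        rw [ENNReal.ofReal_toReal hDfin]
    _ = _ := by
        rw [← ENNReal.ofReal_mul (by positivity)]
        congr 1
        ring

theorem exists_mul_rpow_lt_mul_rpow {c C η e₁ e₂ : ℝ} (hc : 0 < c) (hη : 0 < η) (he : e₁ < e₂) :
    ∃ h : ℝ, 0 < h ∧ h ≤ η ∧ C * h ^ e₂ < c * h ^ e₁ := by
  have hlim : Tendsto (fun h : ℝ => C * h ^ (e₂ - e₁)) (𝓝[>] 0) (𝓝 0) := by
    have h1 : ContinuousAt (fun h : ℝ => C * h ^ (e₂ - e₁)) 0 :=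
      continuousAt_const.mul (Real.continuousAt_rpow_const 0 _ (Or.inr (by linarith)))
    have h2 := h1.tendsto
    rw [Real.zero_rpow (by linarith), mul_zero] at h2
    exact h2.mono_left nhdsWithin_le_nhds
  have hev := (hlim.eventually (gt_mem_nhds hc)).and (Ioc_mem_nhdsGT hη)
  obtain ⟨h, h1, h2⟩ := hev.exists
  refine ⟨h, h2.1, h2.2, ?_⟩
  have h3 : h ^ e₂ = h ^ (e₂ - e₁) * h ^ e₁ := by
    rw [← Real.rpow_add h2.1, sub_add_cancel]
  rw [h3, ← mul_assoc]
  exact mul_lt_mul_of_pos_right h1 (Real.rpow_pos_of_pos h2.1 _)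

theorem frequency_rpow {c h : ℝ} (hc : 0 < c) (hh : 0 < h) (N : ℕ) (s : ℝ) :
    (c / (h ^ N) ^ 2) ^ s = c ^ s * h ^ (-(2 * N * s)) := by
  rw [Real.div_rpow hc.le (by positivity), ← pow_mul, ← Real.rpow_natCast h, ← Real.rpow_mul hh.le,
    Real.rpow_neg hh.le, div_eq_mul_inv]
  congr 3
  push_cast
  ring

/-- If `α` vanishes at `0` from the right to an order that is high compared with the distance of `q`
to the critical exponent, then the bounds fail. -/
theorem not_oscBound_of_flat {n : ℕ} [NeZero n] (hodd : Odd n) {α : ℝ → ℝ} (hα : ∀ s, |α s| < 1)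
    (hc : Continuous α) (hneg : ∀ s < 0, 0 < α s) {N : ℕ} (hN : 1 ≤ N)
    (hflat : ∀ t ∈ Set.Icc (0 : ℝ) 1, |primitive α t| ≤ t ^ N)
    {a : RSpace n → RSpace n → ℝ} (ha : IsAmplitude n a) {q : ℝ≥0∞} (hq1 : 1 ≤ q) (hqtop : q ≠ ⊤)
    (hlt : 2 < N * ((3 * n + 1) - 3 * ((n : ℝ) - 1) / 2 * q.toReal)) (p : ℝ≥0∞) :
    ¬ OscBound (metricDist (dualMetric n α)) a p q := by
  intro hb
  obtain ⟨R, c₀, c₁, η, hRfin, hc₀, hc₁, hη, hconc⟩ :=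
    exists_bounded_le_lintegral_slab hodd hα hc hneg ha
  obtain ⟨M, hM⟩ := ha.compactSupport.exists_bound_of_continuous ha.smooth.continuous
  have hd := continuous_metricDist (n := n) hodd hα hc
  have hqr : 1 ≤ q.toReal := by simpa using ENNReal.toReal_mono hqtop hq1
  set Q := q.toReal with hQ
  set m := (n - 1) / 2 with hm
  have hnm : (n : ℝ) = 2 * m + 1 := by
    obtain ⟨k, rfl⟩ := hodd
    have : m = k := by omega
    rw [this]
    push_cast
    ring
  have hNr : (1 : ℝ) ≤ N := by exact_mod_cast hN
  -- the heights `h` for which the tubes of width `r = h ^ N` stay in the slab of this width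
  set η' := min η (min 1 c₁) with hη'
  have hη'0 : 0 < η' := by positivity
  have hlower : ∀ h, 0 < h → h ≤ η' → ∃ g : RSpace n → ℂ, ∃ f : RSpace n → ℂ,
      g = oscOp (metricDist (dualMetric n α)) a (c₁ / (h ^ N) ^ 2) f ∧
      1 ≤ c₁ / (h ^ N) ^ 2 ∧ Measurable f ∧ Measurable g ∧ (∀ y, ‖f y‖ ≤ 1) ∧
      (∀ y ∉ R, f y = 0) ∧ (∀ x, ‖g x‖ ≤ M * (volume R).toReal) ∧
      ENNReal.ofReal (c₀ * h ^ ((1 : ℝ) + 4 * m * N)) ≤ ∫⁻ x in slab n (h ^ N) h, ‖g x‖ₑ ^ 2 := by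
    intro h hh hhη
    have h1 : h ≤ 1 := hhη.trans ((min_le_right _ _).trans (min_le_left _ _))
    have h2 : h ≤ c₁ := hhη.trans ((min_le_right _ _).trans (min_le_right _ _))
    have h3 : h ≤ η := hhη.trans (min_le_left _ _)
    have hpow : h ^ N ≤ h := pow_le_of_le_one hh.le h1 (by omega)
    have hpow0 : 0 < h ^ N := pow_pos hh N
    obtain ⟨f, hf, hf1, hfR, hle⟩ := hconc (h ^ N) h hpow0 (hpow.trans h3) hh h3
      (fun t ht => (hflat t ⟨ht.1, ht.2.trans h1⟩).trans (pow_le_pow_left₀ ht.1 ht.2 N))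
    refine ⟨_, f, rfl, ?_, hf, measurable_oscOp hd ha.smooth.continuous _ hf, hf1, hfR,
      norm_oscOp_le (fun x y => hM (x, y)) _ hf1 hRfin hfR, ?_⟩
    · rw [le_div_iff₀ (by positivity), one_mul]
      calc (h ^ N) ^ 2 ≤ h ^ N := pow_le_of_le_one hpow0.le (hpow.trans h1) two_ne_zero
        _ ≤ c₁ := hpow.trans h2
    · refine le_trans (le_of_eq ?_) hle
      congr 2
      rw [Real.rpow_add hh, Real.rpow_one, ← pow_mul, ← pow_mul, ← Real.rpow_natCast h]
      congr 2
      push_cast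
      ring
  rcases le_total 2 q with hq2 | hq2
  · -- Hölder's inequality on the slab turns the `L^q` bound into an `L²` bound there; `ε` is
    -- chosen so that half of the gap between the powers of `h` remains.
    have hQ2 : 2 ≤ Q := by simpa using ENNReal.toReal_mono hqtop hq2
    set G := N * ((3 * n + 1) - 3 * ((n : ℝ) - 1) / 2 * Q) - 2 with hG
    have hG0 : 0 < G := by linarith
    set ε := G / (8 * N * Q) with hε
    have hε0 : 0 < ε := by positivity
    obtain ⟨C, hC0, hC⟩ := hb.exists_bound_of_bounded hRfin hε0
    set s := -((n : ℝ) / Q) + ε with hs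
    set e₂ := -(2 * N * s) * 2 + (1 + m * N) * (1 - 2 / Q) with he₂
    have hgap : (1 : ℝ) + 4 * m * N < e₂ := by
      have : e₂ - (1 + 4 * m * N) = G / (2 * Q) := by
        rw [he₂, hs, hε, hG, hnm]
        field_simp
        ring
      have h2 : 0 < G / (2 * Q) := by positivity
      linarith
    obtain ⟨h, hh, hhη, hcontra⟩ := exists_mul_rpow_lt_mul_rpow
      (C := (C * c₁ ^ s) ^ 2 * (4 ^ m) ^ (1 - 2 / Q)) hc₀ hη'0 hgap
    obtain ⟨g, f, rfl, hlam, hf, hg, hf1, hfR, -, hle⟩ := hlower h hh hhη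
    have h1 := hC _ hlam f hf hf1 hfR
    have h2 := hle.trans (lintegral_sq_le_of_two_le hg (slab n (h ^ N) h) hq2)
    rw [volume_slab hodd (by positivity) hh.le] at h2
    rw [frequency_rpow hc₁ hh] at h1
    have hexp : 0 ≤ 1 - 2 / Q := by
      rw [sub_nonneg, div_le_one (by linarith)]
      exact hQ2
    have h3 : c₀ * h ^ ((1 : ℝ) + 4 * m * N) ≤
        (C * (c₁ ^ s * h ^ (-(2 * N * s)))) ^ 2 * (h * (4 * h ^ N) ^ m) ^ (1 - 2 / Q) := by
      rw [← ENNReal.ofReal_le_ofReal_iff (by positivity)]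
      have h4 : ∀ X Y : ℝ, 0 ≤ X → 0 ≤ Y → ENNReal.ofReal (X ^ 2 * Y ^ (1 - 2 / Q)) =
          ENNReal.ofReal X ^ 2 * ENNReal.ofReal Y ^ (1 - 2 / Q) := fun X Y hX hY => by
        rw [ENNReal.ofReal_mul (by positivity), ENNReal.ofReal_pow hX,
          ENNReal.ofReal_rpow_of_nonneg hY hexp]
      rw [h4 _ _ (by positivity) (by positivity)]
      refine h2.trans ?_
      gcongr
    have h4 : (h * (4 * h ^ N) ^ m) ^ (1 - 2 / Q) =
        (4 ^ m) ^ (1 - 2 / Q) * h ^ ((1 + m * N) * (1 - 2 / Q)) := by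
      rw [Real.rpow_mul hh.le, ← Real.mul_rpow (by positivity) (by positivity), mul_pow,
        Real.rpow_add hh, Real.rpow_one, ← pow_mul, ← Real.rpow_natCast h]
      congr 1
      push_cast
      rw [mul_comm (N : ℝ)]
      ring
    rw [h4] at h3
    rw [he₂, Real.rpow_add hh (-(2 * N * s) * 2), Real.rpow_mul hh.le _ 2, Real.rpow_two]
      at hcontra
    refine absurd h3 (not_le.2 (lt_of_eq_of_lt ?_ hcontra))
    ring
  · -- For `q ≤ 2` the image is bounded, so its `L^q` norm controls its `L²` norm without any use
    -- of the slab.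
    have hQ2 : Q ≤ 2 := by simpa using ENNReal.toReal_mono ENNReal.ofNat_ne_top hq2
    have hε0 : (0 : ℝ) < 1 / 8 := by norm_num
    obtain ⟨C, hC0, hC⟩ := hb.exists_bound_of_bounded hRfin hε0
    set s := -((n : ℝ) / Q) + 1 / 8 with hs
    set e₂ := -(2 * N * s) * Q with he₂
    have hgap : (1 : ℝ) + 4 * m * N < e₂ := by
      have : e₂ - (1 + 4 * m * N) = 2 * N - N * Q / 4 - 1 := by
        rw [he₂, hs, hnm]
        field_simp
        ring
      nlinarith
    set B := M * (volume R).toReal with hBdef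
    obtain ⟨h, hh, hhη, hcontra⟩ := exists_mul_rpow_lt_mul_rpow
      (C := B ^ (2 - Q) * (C * c₁ ^ s) ^ Q) hc₀ hη'0 hgap
    obtain ⟨g, f, rfl, hlam, hf, hg, hf1, hfR, hgB, hle⟩ := hlower h hh hhη
    have hB0 : 0 ≤ B := (norm_nonneg _).trans (hgB 0)
    have h1 := hC _ hlam f hf hf1 hfR
    have h2 := hle.trans (lintegral_sq_le_of_le_two hgB (slab n (h ^ N) h)
      (zero_lt_one.trans_le hq1).ne' hq2)
    rw [frequency_rpow hc₁ hh] at h1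
    have hBQ : 0 ≤ B ^ (2 - Q) := Real.rpow_nonneg hB0 _
    have h3 : c₀ * h ^ ((1 : ℝ) + 4 * m * N) ≤
        B ^ (2 - Q) * (C * (c₁ ^ s * h ^ (-(2 * N * s)))) ^ Q := by
      rw [← ENNReal.ofReal_le_ofReal_iff (mul_nonneg hBQ (by positivity))]
      have h4 : ∀ X : ℝ, 0 ≤ X → ENNReal.ofReal (B ^ (2 - Q) * X ^ Q) =
          ENNReal.ofReal B ^ (2 - Q) * ENNReal.ofReal X ^ Q := fun X hX => by
        rw [ENNReal.ofReal_mul hBQ, ENNReal.ofReal_rpow_of_nonneg hB0 (by linarith),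
          ENNReal.ofReal_rpow_of_nonneg hX (by linarith)]
      rw [h4 _ (by positivity)]
      refine h2.trans ?_
      gcongr
    rw [← mul_assoc C, Real.mul_rpow (x := C * c₁ ^ s) (by positivity) (by positivity), ← Real.rpow_mul hh.le,
      ← he₂, ← mul_assoc] at h3
    exact absurd h3 (not_le.2 hcontra)

end

/-! ### The examples -/

theorem exists_isAmplitude (n : ℕ) [NeZero n] : ∃ a, IsAmplitude n a := by
  let φ : ContDiffBump ((0, basePoint n) : RSpace n × RSpace n) :=
    ⟨1 / 8, 1 / 4, by norm_num, by norm_num⟩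
  have hnorm : ‖basePoint n‖ = 1 := by simp [basePoint]
  refine ⟨fun x y => φ (x, y), φ.contDiff, φ.hasCompactSupport, fun x y => φ.nonneg,
    fun x => ?_, ?_⟩
  · have hx : (x, x) ∉ tsupport φ := by
      rw [φ.tsupport_eq, Metric.mem_closedBall, Prod.dist_eq, max_le_iff]
      rintro ⟨h1, h2⟩
      have h3 := dist_triangle_left (0 : RSpace n) (basePoint n) x
      rw [dist_zero_left, hnorm] at h3
      have h4 : φ.rOut = 1 / 4 := rfl
      simp only [h4] at h1 h2
      linarith
    exact notMem_tsupport_iff_eventuallyEq.1 hx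
  · have : φ (0, basePoint n) = 1 := φ.one_of_mem_closedBall (Metric.mem_closedBall_self φ.rIn_pos.le)
    simp [this]

theorem flatAlpha_eq_expNegInvGlue (s : ℝ) : flatAlpha s = expNegInvGlue (-s) := by
  unfold flatAlpha expNegInvGlue
  by_cases h : s < 0
  · rw [if_pos h, if_neg (by linarith), one_div, inv_neg, neg_neg]
  · rw [if_neg h, if_pos (by linarith)]

theorem contDiff_flatAlpha : ContDiff ℝ ∞ flatAlpha := by
  rw [funext flatAlpha_eq_expNegInvGlue]
  exact expNegInvGlue.contDiff.comp contDiff_neg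

theorem abs_flatAlpha_lt_one (s : ℝ) : |flatAlpha s| < 1 := by
  unfold flatAlpha
  split_ifs with h
  · rw [abs_of_pos (Real.exp_pos _), Real.exp_lt_one_iff]
    exact one_div_neg.2 h
  · simp

theorem primitive_flatAlpha {t : ℝ} (ht : 0 ≤ t) : primitive flatAlpha t = 0 := by
  unfold primitive
  rw [intervalIntegral.integral_congr (g := fun _ => 0), intervalIntegral.integral_zero]
  intro s hs
  rw [Set.uIcc_of_le ht] at hs
  simp [flatAlpha, hs.1.not_gt]

/-- A real analytic function with values in `[0, 1)`, positive except for a zero of order `2 N`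
at `0`. -/
noncomputable def analyticAlpha (N : ℕ) (s : ℝ) : ℝ := (s ^ 2 / (1 + s ^ 2)) ^ N

theorem contDiff_analyticAlpha (N : ℕ) : ContDiff ℝ ω (analyticAlpha N) :=
  ((contDiff_id.pow 2).div (contDiff_const.add (contDiff_id.pow 2))
    fun s : ℝ => (by positivity : (1 : ℝ) + s ^ 2 ≠ 0)).pow N

theorem abs_analyticAlpha_lt_one {N : ℕ} (hN : 1 ≤ N) (s : ℝ) : |analyticAlpha N s| < 1 := by
  unfold analyticAlpha
  rw [abs_of_nonneg (by positivity)]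
  refine pow_lt_one₀ (by positivity) ?_ (by omega)
  rw [div_lt_one (by positivity)]
  linarith

theorem abs_primitive_analyticAlpha_le {N : ℕ} {t : ℝ} (ht : t ∈ Set.Icc (0 : ℝ) 1) :
    |primitive (analyticAlpha N) t| ≤ t ^ N := by
  have hbound : ∀ s ∈ Set.uIoc 0 t, ‖analyticAlpha N s‖ ≤ t ^ N := by
    intro s hs
    rw [Set.uIoc_of_le ht.1] at hs
    unfold analyticAlpha
    rw [Real.norm_of_nonneg (by positivity)]
    refine pow_le_pow_left₀ (by positivity) ?_ N
    calc s ^ 2 / (1 + s ^ 2) ≤ s ^ 2 := div_le_self (sq_nonneg s) (by nlinarith [sq_nonneg s])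
      _ ≤ t := by nlinarith [hs.1, hs.2, ht.2]
  have h := intervalIntegral.norm_integral_le_of_norm_le_const hbound
  rw [sub_zero, abs_of_nonneg ht.1, Real.norm_eq_abs] at h
  exact h.trans (mul_le_of_le_one_right (pow_nonneg ht.1 N) ht.2)

theorem exists_order_of_lt_critExponent {n : ℕ} (hn : 3 ≤ n) {q : ℝ≥0∞}
    (hq : q < ENNReal.ofReal (critExponent n)) :
    ∃ N : ℕ, 1 ≤ N ∧ 2 < N * ((3 * n + 1) - 3 * ((n : ℝ) - 1) / 2 * q.toReal) := by
  have hn' : (3 : ℝ) ≤ n := by exact_mod_cast hn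
  have h1 : q.toReal < critExponent n := ENNReal.toReal_lt_of_lt_ofReal hq
  rw [critExponent, lt_div_iff₀ (by linarith)] at h1
  have hD : 0 < (3 * n + 1) - 3 * ((n : ℝ) - 1) / 2 * q.toReal := by linarith
  obtain ⟨N, hN⟩ := exists_nat_gt (2 / ((3 * n + 1) - 3 * ((n : ℝ) - 1) / 2 * q.toReal))
  refine ⟨N, ?_, (div_lt_iff₀ hD).1 hN⟩
  have : (0 : ℝ) < N := lt_trans (by positivity) hN
  exact_mod_cast this

theorem not_oscBound_flatAlpha {n : ℕ} [NeZero n] (hn : 3 ≤ n) (hodd : Odd n)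
    {a : RSpace n → RSpace n → ℝ} (ha : IsAmplitude n a) {q : ℝ≥0∞} (hq1 : 1 ≤ q)
    (hq : q < ENNReal.ofReal (critExponent n)) (p : ℝ≥0∞) :
    ¬ OscBound (metricDist (dualMetric n flatAlpha)) a p q := by
  obtain ⟨N, hN, hlt⟩ := exists_order_of_lt_critExponent hn hq
  refine not_oscBound_of_flat hodd abs_flatAlpha_lt_one contDiff_flatAlpha.continuous
    (fun s hs => ?_) hN (fun t ht => ?_) ha hq1 hq.ne_top hlt p
  · rw [flatAlpha, if_pos hs]
    exact Real.exp_pos _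
  · rw [primitive_flatAlpha ht.1, abs_zero]
    exact pow_nonneg ht.1 N

theorem mainTheorem5 (n : ℕ) [NeZero n] (hn : 3 ≤ n) (hodd : Odd n) :
    -- The smooth example: `α(s) = e^{1/s}` for `s < 0` and `α(s) = 0` for `s ≥ 0`.
    IsMetricOfClass ∞ (dualMetric n flatAlpha) ∧
    (∃ a, IsAmplitude n a) ∧
    (∀ a, IsAmplitude n a → ∀ q : ℝ≥0∞, 1 ≤ q →
      (OscBound (metricDist (dualMetric n flatAlpha)) a ∞ q →
        ENNReal.ofReal (critExponent n) ≤ q) ∧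
      (∀ p, ExponentRelation n p q → OscBound (metricDist (dualMetric n flatAlpha)) a p q →
        ENNReal.ofReal (critExponent n) ≤ q)) ∧
    2 * (n : ℝ) / ((n : ℝ) - 1) < critExponent n ∧
    (n = 3 → ∀ a, IsAmplitude n a → ∀ q : ℝ≥0∞, 3 ≤ q → q < 10 / 3 →
      ¬ OscBound (metricDist (dualMetric n flatAlpha)) a ∞ q ∧
      ∀ p, ExponentRelation n p q → ¬ OscBound (metricDist (dualMetric n flatAlpha)) a p q) ∧
    -- The real analytic examples.
    (∀ q : ℝ≥0∞, ENNReal.ofReal (2 * (n : ℝ) / ((n : ℝ) - 1)) ≤ q →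
      q < ENNReal.ofReal (critExponent n) →
      ∃ α : ℝ → ℝ, ContDiff ℝ ω α ∧ (∀ s, |α s| < 1) ∧ α 0 = 0 ∧
        IsMetricOfClass ω (dualMetric n α) ∧
        ∀ a, IsAmplitude n a →
          ¬ OscBound (metricDist (dualMetric n α)) a ∞ q ∧
          ∀ p, ExponentRelation n p q → ¬ OscBound (metricDist (dualMetric n α)) a p q) := by
  have hn' : (3 : ℝ) ≤ n := by exact_mod_cast hn
  refine ⟨isMetricOfClass_dualMetric hodd abs_flatAlpha_lt_one contDiff_flatAlpha,
    exists_isAmplitude n, fun a ha q hq1 => ?_, ?_, fun h3 a ha q hq3 hq => ?_, fun q hq1 hq => ?_⟩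
  · have hfail := fun hq p => not_oscBound_flatAlpha hn hodd ha hq1 hq p
    exact ⟨fun hb => not_lt.1 fun hq => hfail hq _ hb,
      fun p _ hb => not_lt.1 fun hq => hfail hq p hb⟩
  · rw [critExponent, div_lt_div_iff₀ (by linarith) (by linarith)]
    nlinarith
  · have hcrit : ENNReal.ofReal (critExponent n) = 10 / 3 := by
      have : critExponent n = 10 / 3 := by
        rw [critExponent, h3]
        norm_num
      rw [this, ENNReal.ofReal_div_of_pos (by norm_num), ENNReal.ofReal_ofNat,
        ENNReal.ofReal_ofNat]
    have hfail := not_oscBound_flatAlpha hn hodd ha (le_trans (by norm_num) hq3) (hcrit ▸ hq)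
    exact ⟨hfail _, fun p _ => hfail p⟩
  · obtain ⟨N, hN, hlt⟩ := exists_order_of_lt_critExponent hn hq
    have hbd := abs_analyticAlpha_lt_one hN
    have h1q : 1 ≤ q := by
      refine le_trans ?_ hq1
      rw [← ENNReal.ofReal_one]
      refine ENNReal.ofReal_le_ofReal ?_
      rw [le_div_iff₀ (by linarith)]
      linarith
    refine ⟨analyticAlpha N, contDiff_analyticAlpha N, hbd, ?_,
      isMetricOfClass_dualMetric hodd hbd (contDiff_analyticAlpha N), fun a ha => ?_⟩
    · simp [analyticAlpha, show N ≠ 0 by omega]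
    · have hfail := not_oscBound_of_flat hodd hbd (contDiff_analyticAlpha N).continuous
        (fun s hs => pow_pos (div_pos (sq_pos_of_neg hs) (by positivity)) N) hN
        (fun t ht => abs_primitive_analyticAlpha_le ht) ha h1q hq.ne_top hlt
      exact ⟨hfail _, fun p _ => hfail p⟩
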